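/- Conventions. A groupoid $\mathscr G$ with unit space $\mathscr G^{(0)}$ and range and source maps $r,s:\mathscr G\to\mathscr G^{(0)}$ is étale if it is a topological groupoid that is locally compact, Hausdorff and second countable, and $r$ and $s$ are local homeomorphisms. $C_c(\mathscr G)$ is the $*$-algebra of continuous compactly supported functions $\mathscr G\to\mathbb C$ with $$(f_1f_2)(\gamma)=\sum_{r(\eta)=s(\gamma)}f_1(\gamma\eta)f_2(\eta^{-1}),\qquad f^*(\gamma)=\overline{f(\gamma^{-1})}.$$ For $x\in\mathscr G^{(0)}$ let $\lambda_x$ be the representation of $C_c(\mathscr G)$ on $\ell^2(s^{-1}(x))$ given by $\lambda_x(f)\xi(\gamma)=\sum_{s(\eta)=x}f(\gamma\eta^{-1})\xi(\eta)$; $C^*_r(\mathscr G)$ is the completion of $C_c(\mathscr G)$ in the norm $\sup_x\|\lambda_x(f)\|$. $\mathrm{Aut}(\mathscr G)$ is the group of self-homeomorphisms of $\mathscr G$ that respect the groupoid structure. For a homomorphism $\alpha:G\to\mathrm{Aut}(\mathscr G)$ write $\gamma\cdot g=\alpha_{g^{-1}}(\gamma)$. The semidirect product $\mathscr G\rtimes_\alpha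 G$ is the set $\mathscr G\times G$ with the product topology, with $(\gamma,g)(\eta\cdot g,h)=(\gamma\eta,gh)$ whenever $\gamma,\eta$ are composable, and $(\gamma,g)^{-1}=(\gamma^{-1}\cdot g,g^{-1})$; then $r(\gamma,g)=(r(\gamma),e)$ and $s(\gamma,g)=(s(\gamma)\cdot g,e)$. For a C*-algebra $A$ and a homomorphism $\beta:G\to\mathrm{Aut}(A)$, $AG$ is the $*$-algebra of finite sums $\sum_g a_g\delta_g$ with $(a\delta_g)(b\delta_h)=a\beta_g(b)\delta_{gh}$ and $(a\delta_g)^*=\beta_{g^{-1}}(a^*)\delta_{g^{-1}}$. Given a faithful representation $\rho$ of $A$ on a Hilbert space $H$, put $\tilde\rho(a)\xi(g)=\rho(\beta_g^{-1}(a))\xi(g)$ and $u_h\xi(g)=\xi(h^{-1}g)$ on $\ell^2(G,H)$; the reduced crossed product $A\rtimes_{\beta,r}G$ is the completion of $AG$ in the norm $\|\sum_g\tilde\rho(a_g)u_g\|$. Proposition. Let $\mathscr G$ be an étale groupoid, $G$ a countable discrete group, and $\alpha:G\to\mathrm{Aut}(\mathscr G)$ a homomorphism. Then: (1) $\alpha$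 induces an action $\tilde\alpha:G\to\mathrm{Aut}(C^*_r(\mathscr G))$ by $*$-automorphisms such that for all $f\in C_c(\mathscr G)$ and $g\in G$ the element $\tilde\alpha_g(f)$ lies in $C_c(\mathscr G)$ and $\tilde\alpha_g(f)(\gamma)=f(\alpha_g^{-1}(\gamma))$ for all $\gamma\in\mathscr G$. (2) For every faithful representation $\rho$ of $C^*_r(\mathscr G)$ on a Hilbert space used to form the reduced crossed product, there is a $*$-isomorphism $\Phi:C^*_r(\mathscr G)\rtimes_{\tilde\alpha,r}G\to C^*_r(\mathscr G\rtimes_\alpha G)$ such that for all $f\in C_c(\mathscr G)$ and $h\in G$ the element $\Phi(f\delta_h)$ lies in $C_c(\mathscr G\rtimes_\alpha G)$ and, for all $\gamma\in\mathscr G$ and $g\in G$, $$\Phi(f\delta_h)(\gamma,g)=\begin{cases}f(\gamma)&\text{if }g=h,\\0&\text{otherwise.}\end{cases}$$ -/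

import Mathlib

universe u v w

set_option linter.unusedSectionVars false

namespace EtaleGpd

open scoped ENNReal ComplexConjugate

/-- A groupoid structure on a set `𝒢` of arrows. Units are identified with identity arrows, so range
and source are maps `r, s : 𝒢 → 𝒢`; `comp γ η h` is the product `γη`, defined exactly when
`s γ = r η`. -/
class Gpd (𝒢 : Type u) where
  r : 𝒢 → 𝒢
  s : 𝒢 → 𝒢
  inv : 𝒢 → 𝒢
  comp : ∀ γ η : 𝒢, s γ = r η → 𝒢
  r_r : ∀ γ, r (r γ) = r γ
  s_r : ∀ γ, s (r γ) = r γ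
  r_s : ∀ γ, r (s γ) = s γ
  s_s : ∀ γ, s (s γ) = s γ
  r_comp : ∀ γ η h, r (comp γ η h) = r γ
  s_comp : ∀ γ η h, s (comp γ η h) = s η
  assoc : ∀ γ η ζ (h₁ : s γ = r η) (h₂ : s η = r ζ),
    comp (comp γ η h₁) ζ ((s_comp γ η h₁).trans h₂) =
      comp γ (comp η ζ h₂) (h₁.trans (r_comp η ζ h₂).symm)
  id_comp : ∀ γ, comp (r γ) γ (s_r γ) = γ
  comp_id : ∀ γ, comp γ (s γ) (r_s γ).symm = γ
  r_inv : ∀ γ, r (inv γ) = s γ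
  s_inv : ∀ γ, s (inv γ) = r γ
  inv_comp : ∀ γ, comp (inv γ) γ (s_inv γ) = s γ
  comp_inv : ∀ γ, comp γ (inv γ) (r_inv γ).symm = r γ

namespace Gpd
variable {𝒢 : Type u} [Gpd 𝒢]

theorem comp_congr {γ γ' η η' : 𝒢} (h : s γ = r η) (h1 : γ = γ') (h2 : η = η') :
    comp γ η h = comp γ' η' (h1 ▸ h2 ▸ h) := by subst h1 h2; rfl

theorem inv_comp_cancel (γ η : 𝒢) (h : s γ = r η) :
    comp (inv γ) (comp γ η h) (by rw [s_inv, r_comp]) = η := by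
  rw [← assoc _ _ _ (s_inv γ) h, comp_congr _ (inv_comp γ) rfl, comp_congr _ h rfl, id_comp]

theorem comp_inv_cancel (γ η : 𝒢) (h : r γ = r η) :
    comp γ (comp (inv γ) η (by rw [s_inv, h])) (by rw [r_comp, r_inv]) = η := by
  rw [← assoc _ _ _ (r_inv γ).symm (by rw [s_inv, h]), comp_congr _ (comp_inv γ) rfl,
    comp_congr _ h rfl, id_comp]

theorem comp_inv_cancel_right (γ η : 𝒢) (h : s γ = r η) :
    comp (comp γ η h) (inv η) (by rw [s_comp, r_inv]) = γ := by
  rw [assoc _ _ _ h (r_inv η).symm, comp_congr _ rfl (comp_inv η), comp_congr _ rfl h.symm,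
    comp_id]

theorem inv_comp_cancel_right (γ η : 𝒢) (h : s γ = s η) :
    comp (comp γ (inv η) (by rw [h, r_inv])) η (by rw [s_comp, s_inv]) = γ := by
  rw [assoc _ _ _ (by rw [h, r_inv]) (s_inv η), comp_congr _ rfl (inv_comp η),
    comp_congr _ rfl h.symm, comp_id]

theorem inv_inv_eq (γ : 𝒢) : inv (inv γ) = γ := by
  have h := inv_comp_cancel_right (inv (inv γ)) γ (by rw [s_inv, r_inv])
  rw [comp_congr _ (inv_comp (inv γ)) rfl, comp_congr _ (s_inv γ) rfl, id_comp] at h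
  exact h.symm

theorem eq_inv_of_comp (γ η : 𝒢) (h : s γ = r η) (h' : comp γ η h = r γ) : η = inv γ := by
  have h1 := inv_comp_cancel γ η h
  rw [comp_congr _ rfl h', comp_congr _ rfl (s_inv γ).symm, comp_id] at h1
  exact h1.symm

theorem inv_comp_rev (γ η : 𝒢) (h : s γ = r η) :
    inv (comp γ η h) = comp (inv η) (inv γ) (by rw [s_inv, r_inv, h]) := by
  symm
  apply eq_inv_of_comp _ _ (by rw [s_comp, r_comp, r_inv])
  rw [← assoc _ _ _ (by rw [s_comp, r_inv]) (by rw [s_inv, r_inv, h]),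
    comp_congr _ (comp_inv_cancel_right γ η h) rfl, comp_inv, r_comp]

end Gpd

open Gpd

section
variable (𝒢 : Type u) [Gpd 𝒢]

/-- The unit space `𝒢⁽⁰⁾`, a subset of `𝒢`. -/
def units : Set 𝒢 := {x | r x = x}

variable {𝒢}
/-- The range map `r : 𝒢 → 𝒢⁽⁰⁾`. -/
def rangeMap (γ : 𝒢) : units 𝒢 := ⟨r γ, r_r γ⟩
/-- The source map `s : 𝒢 → 𝒢⁽⁰⁾`. -/
def sourceMap (γ : 𝒢) : units 𝒢 := ⟨s γ, r_s γ⟩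

/-- The source fibre `𝒢ₓ = s⁻¹(x)`. -/
abbrev sourceFiber (x : units 𝒢) : Type u := {γ : 𝒢 // s γ = x}

/-- `γ η⁻¹` for `γ, η` in the same source fibre -/
def divFiber {x : units 𝒢} (γ η : sourceFiber x) : 𝒢 :=
  comp γ.1 (inv η.1) ((γ.2.trans η.2.symm).trans (r_inv η.1).symm)

end

/-- A topological groupoid (inversion and multiplication are continuous) that is étale: locally
compact, Hausdorff, second countable, with `r` and `s` local homeomorphisms onto the unit space. -/
class IsEtale (𝒢 : Type u) [TopologicalSpace 𝒢] [Gpd 𝒢] : Prop where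
  continuous_inv : Continuous (inv : 𝒢 → 𝒢)
  continuous_comp : Continuous fun p : {p : 𝒢 × 𝒢 // s p.1 = r p.2} => comp p.1.1 p.1.2 p.2
  locallyCompact : LocallyCompactSpace 𝒢
  t2 : T2Space 𝒢
  secondCountable : SecondCountableTopology 𝒢
  isLocalHomeomorph_range : IsLocalHomeomorph (rangeMap : 𝒢 → units 𝒢)
  isLocalHomeomorph_source : IsLocalHomeomorph (sourceMap : 𝒢 → units 𝒢)

section Kernel

/-- The matrix `k` has finite rows and columns, with row and column sums bounded by `C`. -/
structure KernelBound {I : Type u} (k : I → I → ℂ) (C : ℝ) : Prop where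
  row_finite : ∀ i, {j | k i j ≠ 0}.Finite
  col_finite : ∀ j, {i | k i j ≠ 0}.Finite
  row_le : ∀ i (F : Finset I), ∑ j ∈ F, ‖k i j‖ ≤ C
  col_le : ∀ j (F : Finset I), ∑ i ∈ F, ‖k i j‖ ≤ C

variable {I : Type u} {k l : I → I → ℂ} {C : ℝ}

theorem KernelBound.nonneg [Nonempty I] (h : KernelBound k C) : 0 ≤ C := by
  simpa using h.row_le (Classical.arbitrary I) ∅

theorem tsum_kernel_eq (i : I) (ξ : I → ℂ) (F : Finset I)
    (hF : ∀ j, k i j ≠ 0 → j ∈ F) : ∑' j, k i j * ξ j = ∑ j ∈ F, k i j * ξ j :=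
  tsum_eq_sum fun j hj => by
    by_contra hne
    exact hj (hF j fun h0 => hne (by rw [h0, zero_mul]))

theorem KernelBound.summable (h : KernelBound k C) (i : I) (ξ : I → ℂ) :
    Summable fun j => k i j * ξ j :=
  summable_of_hasFiniteSupport ((h.row_finite i).subset fun j hj h0 => hj (by simp [h0]))

theorem KernelBound.sum_sq_le (h : KernelBound k C) (hC : 0 ≤ C) (ξ : lp (fun _ : I => ℂ) 2)
    (F : Finset I) : ∑ i ∈ F, ‖∑' j, k i j * ξ j‖ ^ 2 ≤ (C * ‖ξ‖) ^ 2 := by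
  classical
  set J : Finset I := F.biUnion fun i => (h.row_finite i).toFinset with hJ
  have hJm : ∀ i ∈ F, ∀ j, k i j ≠ 0 → j ∈ J := fun i hi j hj => by
    rw [hJ, Finset.mem_biUnion]; exact ⟨i, hi, by simpa using hj⟩
  have h1 : ∀ i ∈ F, ‖∑' j, k i j * ξ j‖ ^ 2 ≤ C * ∑ j ∈ J, ‖k i j‖ * ‖ξ j‖ ^ 2 := by
    intro i hi
    rw [tsum_kernel_eq i ξ J (hJm i hi)]
    have h2 : ‖∑ j ∈ J, k i j * ξ j‖ ≤ ∑ j ∈ J, ‖k i j‖ * ‖ξ j‖ :=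
      (norm_sum_le _ _).trans (le_of_eq (Finset.sum_congr rfl fun j _ => norm_mul _ _))
    have h3 : (∑ j ∈ J, ‖k i j‖ * ‖ξ j‖) ^ 2 ≤
        (∑ j ∈ J, ‖k i j‖) * ∑ j ∈ J, ‖k i j‖ * ‖ξ j‖ ^ 2 := by
      apply Finset.sum_sq_le_sum_mul_sum_of_sq_le_mul
      · intros; positivity
      · intros; positivity
      · intros; exact le_of_eq (by ring)
    calc _ ≤ (∑ j ∈ J, ‖k i j‖ * ‖ξ j‖) ^ 2 := by gcongr
      _ ≤ _ := h3
      _ ≤ _ := by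
        gcongr
        exact h.row_le i J
  have h4 : ∑ j ∈ J, ‖ξ j‖ ^ 2 ≤ ‖ξ‖ ^ 2 := by
    have := lp.sum_rpow_le_norm_rpow (p := 2) (by norm_num) ξ J
    simpa using this
  calc _ ≤ ∑ i ∈ F, C * ∑ j ∈ J, ‖k i j‖ * ‖ξ j‖ ^ 2 := Finset.sum_le_sum h1
    _ = C * ∑ j ∈ J, (∑ i ∈ F, ‖k i j‖) * ‖ξ j‖ ^ 2 := by
      rw [← Finset.mul_sum, Finset.sum_comm]; simp_rw [Finset.sum_mul]
    _ ≤ C * ∑ j ∈ J, C * ‖ξ j‖ ^ 2 := by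
      gcongr with j _
      exact h.col_le j F
    _ = C ^ 2 * ∑ j ∈ J, ‖ξ j‖ ^ 2 := by rw [← Finset.mul_sum]; ring
    _ ≤ C ^ 2 * ‖ξ‖ ^ 2 := by gcongr
    _ = _ := by ring

/-- The bounded operator on `ℓ²(I)` with matrix `k`. -/
noncomputable def kernelOp (k : I → I → ℂ) (C : ℝ) (hC : 0 ≤ C) (h : KernelBound k C) :
    lp (fun _ : I => ℂ) 2 →L[ℂ] lp (fun _ : I => ℂ) 2 :=
  LinearMap.mkContinuous
    { toFun := fun ξ => ⟨fun i => ∑' j, k i j * ξ j,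
        memℓp_gen' (C := (C * ‖ξ‖) ^ 2) fun F => by simpa using h.sum_sq_le hC ξ F⟩
      map_add' := fun ξ η => by
        ext i
        simp only [lp.coeFn_add, Pi.add_apply, mul_add]
        exact (h.summable i ξ).tsum_add (h.summable i η)
      map_smul' := fun c ξ => by
        ext i
        simp only [lp.coeFn_smul, Pi.smul_apply, smul_eq_mul, RingHom.id_apply]
        rw [← tsum_mul_left]
        exact tsum_congr fun j => by ring }
    C fun ξ => by
      apply lp.norm_le_of_forall_sum_le (p := 2) (by norm_num) (by positivity)
      intro F
      simpa using h.sum_sq_le hC ξ F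

variable (hC : 0 ≤ C) (h : KernelBound k C)

theorem kernelOp_apply (ξ : lp (fun _ : I => ℂ) 2) (i : I) :
    kernelOp k C hC h ξ i = ∑' j, k i j * ξ j := rfl

theorem norm_kernelOp_le : ‖kernelOp k C hC h‖ ≤ C := LinearMap.mkContinuous_norm_le _ hC _

theorem kernelOp_single [DecidableEq I] (i j : I) :
    kernelOp k C hC h (lp.single 2 j 1) i = k i j := by
  rw [kernelOp_apply, tsum_eq_single j]
  · simp
  · intro j' hj'; simp [hj']

theorem ext_single [DecidableEq I] {S T : lp (fun _ : I => ℂ) 2 →L[ℂ] lp (fun _ : I => ℂ) 2}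
    (h : ∀ i j, S (lp.single 2 j 1) i = T (lp.single 2 j 1) i) : S = T := by
  apply lp.ext_continuousLinearMap (by norm_num)
  intro j
  ext
  simpa using h _ j

theorem kernelOp_adjoint (h' : KernelBound (fun i j => conj (k j i)) C) :
    ContinuousLinearMap.adjoint (kernelOp k C hC h) = kernelOp _ C hC h' := by
  classical
  apply ext_single
  intro i j
  rw [kernelOp_single]
  have h1 := lp.inner_single_left (𝕜 := ℂ) i (1:ℂ)
    (ContinuousLinearMap.adjoint (kernelOp k C hC h) (lp.single 2 j 1))
  rw [ContinuousLinearMap.adjoint_inner_right, lp.inner_single_right, kernelOp_single] at h1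
  simpa using h1.symm

theorem kernelOp_mul {m : I → I → ℂ} {D E : ℝ} (hD : 0 ≤ D) (hE : 0 ≤ E) (hl : KernelBound l D)
    (hm : KernelBound m E) (hmul : ∀ i j, m i j = ∑' n, k i n * l n j) :
    kernelOp m E hE hm = kernelOp k C hC h * kernelOp l D hD hl := by
  classical
  apply ext_single
  intro i j
  rw [kernelOp_single, mul_apply_eq_comp, kernelOp_apply, hmul]
  exact tsum_congr fun n => by rw [kernelOp_single]

end Kernel

section Conv

variable {𝒢 : Type u} [TopologicalSpace 𝒢]

variable (𝒢) in
/-- `C_c(𝒢)`: the continuous compactly supported functions `𝒢 → ℂ`. A copy of Mathlib's type, so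
that the convolution product below does not clash with the pointwise product. -/
def Cc : Type u := CompactlySupportedContinuousMap 𝒢 ℂ

namespace Cc

noncomputable instance : AddCommGroup (Cc 𝒢) :=
  inferInstanceAs (AddCommGroup (CompactlySupportedContinuousMap 𝒢 ℂ))
noncomputable instance : Module ℂ (Cc 𝒢) :=
  inferInstanceAs (Module ℂ (CompactlySupportedContinuousMap 𝒢 ℂ))
instance : FunLike (Cc 𝒢) 𝒢 ℂ := inferInstanceAs (FunLike (CompactlySupportedContinuousMap 𝒢 ℂ) 𝒢 ℂ)

@[ext] theorem ext {f g : Cc 𝒢} (h : ∀ γ, f γ = g γ) : f = g := DFunLike.ext _ _ h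

theorem continuous (f : Cc 𝒢) : Continuous f :=
  ContinuousMap.continuous (CompactlySupportedContinuousMap.toContinuousMap f)
theorem hasCompactSupport (f : Cc 𝒢) : HasCompactSupport f :=
  CompactlySupportedContinuousMap.hasCompactSupport' f

theorem add_apply (f g : Cc 𝒢) (γ : 𝒢) : (f + g) γ = f γ + g γ := rfl
theorem smul_apply (c : ℂ) (f : Cc 𝒢) (γ : 𝒢) : (c • f) γ = c * f γ := rfl
theorem zero_apply (γ : 𝒢) : (0 : Cc 𝒢) γ = 0 := rfl

/-- A continuous compactly supported function as an element of `C_c(𝒢)`. -/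
def mk (f : 𝒢 → ℂ) (hf : Continuous f) (hs : HasCompactSupport f) : Cc 𝒢 :=
  (⟨⟨f, hf⟩, hs⟩ : CompactlySupportedContinuousMap 𝒢 ℂ)

@[simp] theorem mk_apply (f : 𝒢 → ℂ) (hf : Continuous f) (hs : HasCompactSupport f) (γ : 𝒢) :
    mk f hf hs γ = f γ := rfl

end Cc

variable [Gpd 𝒢]

theorem IsEtale.continuous_rangeMap [IsEtale 𝒢] : Continuous (rangeMap : 𝒢 → units 𝒢) :=
  IsEtale.isLocalHomeomorph_range.continuous
theorem IsEtale.continuous_r [IsEtale 𝒢] : Continuous (r : 𝒢 → 𝒢) :=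
  continuous_subtype_val.comp IsEtale.continuous_rangeMap
theorem IsEtale.continuous_s [IsEtale 𝒢] : Continuous (s : 𝒢 → 𝒢) :=
  continuous_subtype_val.comp (IsEtale.isLocalHomeomorph_source (𝒢 := 𝒢)).continuous

variable [IsEtale 𝒢]

namespace Cc

theorem exists_bound_aux {p : 𝒢 → units 𝒢} (hp : IsLocalHomeomorph p) (f : Cc 𝒢) :
    ∃ C : ℝ, 0 ≤ C ∧ ∀ u, {γ | p γ = u ∧ f γ ≠ 0}.Finite ∧
      ∀ F : Finset 𝒢, (∀ γ ∈ F, p γ = u) → ∑ γ ∈ F, ‖f γ‖ ≤ C := by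
  classical
  obtain ⟨M, hM⟩ := f.hasCompactSupport.exists_bound_of_continuous f.continuous
  have hU : ∀ γ, ∃ U ∈ nhds γ, Set.InjOn p U := fun γ => by
    obtain ⟨e, he, rfl⟩ := hp γ
    exact ⟨e.source, e.open_source.mem_nhds he, e.injOn⟩
  choose U hU hinj using hU
  obtain ⟨t, -, ht⟩ := f.hasCompactSupport.isCompact.elim_nhds_subcover U fun γ _ => hU γ
  have hcov : ∀ γ, f γ ≠ 0 → ∃ x ∈ t, γ ∈ U x := fun γ hγ => by
    simpa using ht (subset_tsupport _ hγ)
  refine ⟨t.card * max M 0, by positivity, fun u => ⟨?_, fun F hF => ?_⟩⟩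
  · refine (t.finite_toSet.biUnion (t := fun x => {γ | γ ∈ U x ∧ p γ = u}) fun x _ =>
      Set.Subsingleton.finite ?_).subset ?_
    · rintro a ⟨ha, ha'⟩ b ⟨hb, hb'⟩
      exact hinj x ha hb (ha'.trans hb'.symm)
    · rintro γ ⟨h1, h2⟩
      obtain ⟨x, hx, hγ⟩ := hcov γ h2
      simp only [Set.mem_iUnion]
      exact ⟨x, hx, hγ, h1⟩
  · have h1 : ∑ γ ∈ F, ‖f γ‖ = ∑ γ ∈ F with f γ ≠ 0, ‖f γ‖ := by
      rw [Finset.sum_filter]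
      refine Finset.sum_congr rfl fun γ _ => ?_
      by_cases h : f γ = 0 <;> simp [h]
    have h2 : (F.filter fun γ => f γ ≠ 0).card ≤ t.card := by
      have : ∀ γ : 𝒢, ∃ x, f γ ≠ 0 → x ∈ t ∧ γ ∈ U x := fun γ => by
        by_cases h : f γ = 0
        · exact ⟨γ, fun h' => absurd h h'⟩
        · obtain ⟨x, hx⟩ := hcov γ h
          exact ⟨x, fun _ => hx⟩
      choose c hc using this
      refine Finset.card_le_card_of_injOn c (fun γ hγ => (hc γ (Finset.mem_filter.1 hγ).2).1) ?_
      intro a ha b hb hab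
      have ha := Finset.mem_filter.1 ha
      have hb := Finset.mem_filter.1 hb
      refine hinj (c a) (hc a ha.2).2 (hab ▸ (hc b hb.2).2) ?_
      rw [hF a ha.1, hF b hb.1]
    rw [h1]
    calc _ ≤ ∑ γ ∈ F with f γ ≠ 0, max M 0 :=
          Finset.sum_le_sum fun γ _ => (hM γ).trans (le_max_left _ _)
      _ = (F.filter fun γ => f γ ≠ 0).card * max M 0 := by simp
      _ ≤ _ := by gcongr

theorem exists_bound (f : Cc 𝒢) :
    ∃ C : ℝ, 0 ≤ C ∧ ∀ u : 𝒢, ({γ | r γ = u ∧ f γ ≠ 0}.Finite ∧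
      ∀ F : Finset 𝒢, (∀ γ ∈ F, r γ = u) → ∑ γ ∈ F, ‖f γ‖ ≤ C) ∧
      ({γ | s γ = u ∧ f γ ≠ 0}.Finite ∧
      ∀ F : Finset 𝒢, (∀ γ ∈ F, s γ = u) → ∑ γ ∈ F, ‖f γ‖ ≤ C) := by
  obtain ⟨C, hC, h⟩ := f.exists_bound_aux IsEtale.isLocalHomeomorph_range
  obtain ⟨D, hD, h'⟩ := f.exists_bound_aux IsEtale.isLocalHomeomorph_source
  refine ⟨max C D, le_max_of_le_left hC, fun u => ⟨⟨?_, fun F hF => ?_⟩, ?_, fun F hF => ?_⟩⟩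
  · by_cases hu : r u = u
    · exact (h ⟨u, hu⟩).1.subset fun γ hγ => ⟨Subtype.ext hγ.1, hγ.2⟩
    · convert Set.finite_empty
      ext γ
      simp only [Set.mem_ofPred_eq, Set.mem_empty_iff_false, iff_false]
      rintro ⟨rfl, -⟩
      exact hu (r_r γ)
  · rcases F.eq_empty_or_nonempty with rfl | ⟨γ, hγ⟩
    · simpa using Or.inl hC
    · refine ((h (rangeMap γ)).2 F fun η hη => Subtype.ext ?_).trans (le_max_left _ _)
      exact (hF η hη).trans (hF γ hγ).symm
  · by_cases hu : r u = u
    · exact (h' ⟨u, hu⟩).1.subset fun γ hγ => ⟨Subtype.ext hγ.1, hγ.2⟩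
    · convert Set.finite_empty
      ext γ
      simp only [Set.mem_ofPred_eq, Set.mem_empty_iff_false, iff_false]
      rintro ⟨rfl, -⟩
      exact hu (r_s γ)
  · rcases F.eq_empty_or_nonempty with rfl | ⟨γ, hγ⟩
    · simpa using Or.inl hC
    · refine ((h' (sourceMap γ)).2 F fun η hη => Subtype.ext ?_).trans (le_max_right _ _)
      exact (hF η hη).trans (hF γ hγ).symm

end Cc

theorem divFiber_injective_right {x : units 𝒢} (γ : sourceFiber x) :
    Function.Injective fun η => divFiber γ η := by
  intro η η' h
  have h1 := inv_comp_cancel γ.1 (inv η.1) ((γ.2.trans η.2.symm).trans (r_inv η.1).symm)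
  have h2 := inv_comp_cancel γ.1 (inv η'.1) ((γ.2.trans η'.2.symm).trans (r_inv η'.1).symm)
  have h' : comp γ.1 (inv η.1) _ = comp γ.1 (inv η'.1) _ := h
  rw [comp_congr _ rfl h'] at h1
  apply Subtype.ext
  rw [← inv_inv_eq η.1, ← inv_inv_eq η'.1]
  exact congrArg inv (h1.symm.trans h2)

theorem divFiber_injective_left {x : units 𝒢} (η : sourceFiber x) :
    Function.Injective fun γ => divFiber γ η := by
  intro γ γ' h
  have h1 := inv_comp_cancel_right γ.1 η.1 (γ.2.trans η.2.symm)
  have h2 := inv_comp_cancel_right γ'.1 η.1 (γ'.2.trans η.2.symm)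
  have h' : comp γ.1 (inv η.1) _ = comp γ'.1 (inv η.1) _ := h
  rw [comp_congr _ h' rfl] at h1
  apply Subtype.ext
  exact h1.symm.trans h2

theorem r_divFiber {x : units 𝒢} (γ η : sourceFiber x) : r (divFiber γ η) = r γ.1 := r_comp _ _ _
theorem s_divFiber {x : units 𝒢} (γ η : sourceFiber x) : s (divFiber γ η) = r η.1 := by
  rw [divFiber, s_comp, s_inv]

theorem Cc.kernelBound (f : Cc 𝒢) : ∃ C : ℝ, 0 ≤ C ∧ ∀ x : units 𝒢,
    KernelBound (fun γ η : sourceFiber x => f (divFiber γ η)) C := by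
  classical
  obtain ⟨C, hC, h⟩ := f.exists_bound
  refine ⟨C, hC, fun x => ⟨fun γ => ?_, fun η => ?_, fun γ F => ?_, fun η F => ?_⟩⟩
  · exact ((h (r γ.1)).1.1.preimage (divFiber_injective_right γ).injOn).subset
      fun η hη => ⟨r_divFiber γ η, hη⟩
  · exact ((h (r η.1)).2.1.preimage (divFiber_injective_left η).injOn).subset
      fun γ hγ => ⟨s_divFiber γ η, hγ⟩
  · have := (h (r γ.1)).1.2 (F.image fun η => divFiber γ η) (by
      simp only [Finset.mem_image]; rintro _ ⟨η, -, rfl⟩; exact r_divFiber γ η)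
    rwa [Finset.sum_image (divFiber_injective_right γ).injOn] at this
  · have := (h (r η.1)).2.2 (F.image fun γ => divFiber γ η) (by
      simp only [Finset.mem_image]; rintro _ ⟨γ, -, rfl⟩; exact s_divFiber γ η)
    rwa [Finset.sum_image (divFiber_injective_left η).injOn] at this

/-- Convolution, `(f g)(γ) = ∑_{r(η) = s(γ)} f(γη) g(η⁻¹)` (a finite sum when `f ∈ C_c(𝒢)`). -/
noncomputable def convFun (f g : 𝒢 → ℂ) (γ : 𝒢) : ℂ :=
  ∑' η : {η : 𝒢 // r η = s γ}, f (comp γ η.1 η.2.symm) * g (inv η.1)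

theorem convFun_finite (f : Cc 𝒢) (γ : 𝒢) :
    {η : {η : 𝒢 // r η = s γ} | f (comp γ η.1 η.2.symm) ≠ 0}.Finite := by
  obtain ⟨C, -, h⟩ := f.exists_bound
  have hinj : Function.Injective fun η : {η : 𝒢 // r η = s γ} => comp γ η.1 η.2.symm := by
    intro η η' hh
    apply Subtype.ext
    rw [← inv_comp_cancel γ η.1 η.2.symm, ← inv_comp_cancel γ η'.1 η'.2.symm]
    exact comp_congr _ rfl hh
  exact ((h (r γ)).1.1.preimage hinj.injOn).subset fun η hη => ⟨r_comp _ _ _, hη⟩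

theorem convFun_summable (f : Cc 𝒢) (g : 𝒢 → ℂ) (γ : 𝒢) :
    Summable fun η : {η : 𝒢 // r η = s γ} => f (comp γ η.1 η.2.symm) * g (inv η.1) :=
  summable_of_hasFiniteSupport ((convFun_finite f γ).subset fun η hη h0 => hη (by simp [h0]))

theorem hasCompactSupport_convFun (f g : Cc 𝒢) : HasCompactSupport (convFun f g) := by
  have : T2Space 𝒢 := IsEtale.t2
  have hc : IsClosed {p : 𝒢 × 𝒢 | s p.1 = r p.2} :=
    isClosed_eq (IsEtale.continuous_s.comp continuous_fst) (IsEtale.continuous_r.comp continuous_snd)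
  have hK : IsCompact ((fun p : {p : 𝒢 × 𝒢 // s p.1 = r p.2} => comp p.1.1 p.1.2 p.2) ''
      (Subtype.val ⁻¹' (tsupport f ×ˢ tsupport g))) :=
    (hc.isClosedEmbedding_subtypeVal.isCompact_preimage
      (f.hasCompactSupport.isCompact.prod g.hasCompactSupport.isCompact)).image
      IsEtale.continuous_comp
  refine HasCompactSupport.intro hK fun γ hγ => ?_
  rw [convFun]
  convert tsum_zero with η
  by_contra h0
  apply hγ
  refine ⟨⟨(comp γ η.1 η.2.symm, inv η.1), by rw [s_comp, r_inv]⟩,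
    ⟨subset_tsupport _ (left_ne_zero_of_mul h0), subset_tsupport _ (right_ne_zero_of_mul h0)⟩, ?_⟩
  exact comp_inv_cancel_right _ _ _

theorem continuous_convFun_of_bisection (f g : Cc 𝒢) (e : OpenPartialHomeomorph 𝒢 (units 𝒢))
    (he : (e : 𝒢 → units 𝒢) = rangeMap) (hf : tsupport f ⊆ e.source) :
    Continuous (convFun f g) := by
  have : T2Space 𝒢 := IsEtale.t2
  have hrm : Continuous (rangeMap : 𝒢 → units 𝒢) := IsEtale.continuous_rangeMap
  rw [continuous_iff_continuousAt]
  intro γ₀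
  by_cases h0 : rangeMap γ₀ ∈ e.target
  · have hopen : IsOpen (rangeMap ⁻¹' e.target : Set 𝒢) := e.open_target.preimage hrm
    refine ContinuousOn.continuousAt ?_ (hopen.mem_nhds h0)
    rw [continuousOn_iff_continuous_domRestrict]
    have hα : ∀ γ : (rangeMap ⁻¹' e.target : Set 𝒢), s (inv γ.1) = r (e.symm (rangeMap γ.1)) := by
      intro γ
      have := e.right_inv γ.2
      rw [he] at this
      rw [s_inv]
      exact (congrArg Subtype.val this).symm
    have hαc : Continuous fun γ : (rangeMap ⁻¹' e.target : Set 𝒢) => e.symm (rangeMap γ.1) :=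
      e.continuousOn_symm.comp_continuous (hrm.comp continuous_subtype_val) fun γ => γ.2
    have hβc : Continuous fun γ : (rangeMap ⁻¹' e.target : Set 𝒢) =>
        comp (inv γ.1) (e.symm (rangeMap γ.1)) (hα γ) :=
      IsEtale.continuous_comp.comp (Continuous.subtype_mk
        ((IsEtale.continuous_inv.comp continuous_subtype_val).prodMk hαc) hα)
    have heq : Set.domRestrict (rangeMap ⁻¹' e.target) (convFun f g) = fun γ =>
        f (e.symm (rangeMap γ.1)) * g (inv (comp (inv γ.1) (e.symm (rangeMap γ.1)) (hα γ))) := by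
      funext γ
      rw [Set.domRestrict_apply, convFun, tsum_eq_single
        ⟨comp (inv γ.1) (e.symm (rangeMap γ.1)) (hα γ), by rw [r_comp, r_inv]⟩]
      · congr 2
        exact comp_inv_cancel _ _ (by rw [← hα, s_inv])
      · intro η hη
        by_contra hne
        apply hη
        have h1 : comp γ.1 η.1 η.2.symm ∈ e.source :=
          hf (subset_tsupport _ (left_ne_zero_of_mul hne))
        have h2 := e.left_inv h1
        have h3 : e (comp γ.1 η.1 η.2.symm) = rangeMap γ.1 := by
          rw [he]; exact Subtype.ext (r_comp _ _ _)
        rw [h3] at h2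
        apply Subtype.ext
        change η.1 = _
        rw [← inv_comp_cancel γ.1 η.1 η.2.symm]
        exact comp_congr _ rfl h2.symm
    rw [heq]
    exact (f.continuous.comp hαc).mul
      (g.continuous.comp ((IsEtale.continuous_inv (𝒢 := 𝒢)).comp hβc))
  · have hcl : IsClosed (rangeMap '' tsupport f : Set (units 𝒢)) :=
      (f.hasCompactSupport.isCompact.image hrm).isClosed
    have hopen : IsOpen (rangeMap ⁻¹' (rangeMap '' tsupport f)ᶜ : Set 𝒢) :=
      hcl.isOpen_compl.preimage hrm
    have hmem : γ₀ ∈ (rangeMap ⁻¹' (rangeMap '' tsupport f)ᶜ : Set 𝒢) := by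
      rintro ⟨γ, hγ, hγ'⟩
      apply h0
      rw [← hγ', ← he]
      exact e.map_source (hf hγ)
    have hz : convFun f g =ᶠ[nhds γ₀] fun _ => 0 := by
      filter_upwards [hopen.mem_nhds hmem] with γ hγ
      rw [convFun]
      convert tsum_zero with η
      by_contra hne
      exact hγ ⟨comp γ η.1 η.2.symm, subset_tsupport _ (left_ne_zero_of_mul hne),
        Subtype.ext (r_comp _ _ _)⟩
    exact (continuousAt_const.congr hz.symm)

theorem continuous_convFun (f g : Cc 𝒢) : Continuous (convFun f g) := by
  have : T2Space 𝒢 := IsEtale.t2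
  have : LocallyCompactSpace 𝒢 := IsEtale.locallyCompact
  choose e he heq using IsEtale.isLocalHomeomorph_range (𝒢 := 𝒢)
  obtain ⟨t, -, ht⟩ := f.hasCompactSupport.isCompact.elim_nhds_subcover (fun γ => (e γ).source)
    fun γ _ => (e γ).open_source.mem_nhds (he γ)
  have hcov : tsupport f ⊆ ⋃ i : Fin t.card, (e (t.equivFin.symm i)).source := by
    intro γ hγ
    obtain ⟨x, hx, hγx⟩ := Set.mem_iUnion₂.1 (ht hγ)
    exact Set.mem_iUnion.2 ⟨t.equivFin ⟨x, hx⟩, by simpa using hγx⟩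
  obtain ⟨φ, hφs, hφ1, -, -⟩ := exists_continuous_sum_one_of_isOpen_isCompact
    (s := fun i : Fin t.card => (e (t.equivFin.symm i)).source)
    (fun i => (e _).open_source) f.hasCompactSupport.isCompact hcov
  let F : Fin t.card → Cc 𝒢 := fun i => Cc.mk (fun γ => (φ i γ : ℂ) * f γ)
    ((Complex.continuous_ofReal.comp (φ i).continuous).mul f.continuous)
    f.hasCompactSupport.mul_left
  have hF : ∀ γ, f γ = ∑ i, F i γ := by
    intro γ
    by_cases h0 : f γ = 0
    · simp [F, h0]
    · have := hφ1 (subset_tsupport _ h0)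
      simp only [Finset.sum_apply, Pi.one_apply] at this
      simp only [F, Cc.mk_apply]
      rw [← Finset.sum_mul, ← Complex.ofReal_sum, this]
      simp
  have hconv : convFun f g = fun γ => ∑ i, convFun (F i) g γ := by
    funext γ
    simp only [convFun]
    rw [← Summable.tsum_finsetSum fun i _ => convFun_summable (F i) g γ]
    exact tsum_congr fun η => by rw [hF, Finset.sum_mul]
  rw [hconv]
  refine continuous_finsetSum _ fun i _ => continuous_convFun_of_bisection (F i) g
    (e (t.equivFin.symm i)) (heq _).symm ?_
  refine Set.Subset.trans (closure_mono fun γ hγ => ?_) (hφs i)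
  intro h0
  apply hγ
  simp [F, h0]

namespace Cc

/-- The convolution product `(f g)(γ) = ∑_{r(η) = s(γ)} f(γη) g(η⁻¹)`. -/
noncomputable instance : Mul (Cc 𝒢) where
  mul f g := mk (convFun f g) (continuous_convFun f g) (hasCompactSupport_convFun f g)

theorem mul_apply (f g : Cc 𝒢) (γ : 𝒢) :
    (f * g) γ = ∑' η : {η : 𝒢 // r η = s γ}, f (comp γ η.1 η.2.symm) * g (inv η.1) := rfl

theorem hasCompactSupport_star (f : Cc 𝒢) : HasCompactSupport fun γ : 𝒢 => conj (f (inv γ)) :=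
  (f.hasCompactSupport.comp_homeomorph
    { toFun := inv, invFun := inv, left_inv := inv_inv_eq, right_inv := inv_inv_eq
      continuous_toFun := IsEtale.continuous_inv
      continuous_invFun := IsEtale.continuous_inv }).comp_left (g := conj) (map_zero _)

/-- The involution `f*(γ) = conj (f(γ⁻¹))`. -/
noncomputable instance : Star (Cc 𝒢) where
  star f := mk (fun γ => conj (f (inv γ)))
    (Complex.continuous_conj.comp (f.continuous.comp IsEtale.continuous_inv))
    f.hasCompactSupport_star

theorem star_apply (f : Cc 𝒢) (γ : 𝒢) : (star f) γ = conj (f (inv γ)) := rfl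

end Cc

/-- `λₓ(f)` on `ℓ²(𝒢ₓ)`: `λₓ(f) ξ (γ) = ∑_{s(η) = x} f(γη⁻¹) ξ(η)`; see `regularRep_apply`. -/
noncomputable def regularRep (x : units 𝒢) (f : Cc 𝒢) :
    lp (fun _ : sourceFiber x => ℂ) 2 →L[ℂ] lp (fun _ : sourceFiber x => ℂ) 2 :=
  kernelOp (fun γ η => f (divFiber γ η)) f.kernelBound.choose f.kernelBound.choose_spec.1
    (f.kernelBound.choose_spec.2 x)

theorem regularRep_apply (x : units 𝒢) (f : Cc 𝒢) (ξ : lp (fun _ : sourceFiber x => ℂ) 2)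
    (γ : sourceFiber x) :
    regularRep x f ξ γ = ∑' η : sourceFiber x, f (divFiber γ η) * ξ η := rfl

theorem regularRep_single [DecidableEq 𝒢] (x : units 𝒢) (f : Cc 𝒢) (γ η : sourceFiber x) :
    regularRep x f (lp.single 2 η 1) γ = f (divFiber γ η) := kernelOp_single _ _ _ _

theorem regularRep_add (x : units 𝒢) (f g : Cc 𝒢) :
    regularRep x (f + g) = regularRep x f + regularRep x g := by
  classical
  refine ext_single fun i j => ?_
  rw [add_apply, lp.coeFn_add, Pi.add_apply]
  simp only [regularRep_single]
  rfl

theorem regularRep_smul (x : units 𝒢) (c : ℂ) (f : Cc 𝒢) :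
    regularRep x (c • f) = c • regularRep x f := by
  classical
  refine ext_single fun i j => ?_
  rw [smul_apply, lp.coeFn_smul, Pi.smul_apply]
  simp only [regularRep_single]
  rfl

theorem conj_divFiber_inv {x : units 𝒢} (γ η : sourceFiber x) :
    inv (divFiber γ η) = divFiber η γ := by
  rw [divFiber, inv_comp_rev]
  exact comp_congr _ (inv_inv_eq _) rfl

theorem regularRep_star (x : units 𝒢) (f : Cc 𝒢) :
    regularRep x (star f) = star (regularRep x f) := by
  classical
  have hk : (fun γ η : sourceFiber x => (star f) (divFiber γ η)) =
      fun γ η => conj (f (divFiber η γ)) := by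
    funext γ η; rw [Cc.star_apply, conj_divFiber_inv]
  have h := f.kernelBound.choose_spec.2 x
  have h' : KernelBound (fun γ η : sourceFiber x => conj (f (divFiber η γ)))
      f.kernelBound.choose :=
    ⟨fun i => by simpa using h.col_finite i, fun i => by simpa using h.row_finite i,
      fun i F => by simpa using h.col_le i F, fun i F => by simpa using h.row_le i F⟩
  rw [ContinuousLinearMap.star_eq_adjoint]
  unfold regularRep
  rw [kernelOp_adjoint f.kernelBound.choose_spec.1 h h']
  change regularRep x (star f) = _
  refine ext_single fun i j => ?_
  rw [regularRep_single, kernelOp_single, Cc.star_apply, conj_divFiber_inv]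

theorem conv_divFiber (x : units 𝒢) (f g : Cc 𝒢) (γ ζ : sourceFiber x) :
    (f * g) (divFiber γ ζ) = ∑' η : sourceFiber x, f (divFiber γ η) * g (divFiber η ζ) := by
  rw [Cc.mul_apply]
  let E : sourceFiber x ≃ {β : 𝒢 // r β = s (divFiber γ ζ)} :=
    { toFun := fun η => ⟨divFiber ζ η, by rw [r_divFiber, s_divFiber]⟩
      invFun := fun β => ⟨comp (inv β.1) ζ.1 (by rw [s_inv, β.2, s_divFiber]),
        by rw [s_comp, ζ.2]⟩
      left_inv := fun η => Subtype.ext (by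
        change comp (inv (divFiber ζ η)) ζ.1 _ = η.1
        rw [comp_congr _ (conj_divFiber_inv ζ η) rfl]
        exact inv_comp_cancel_right η.1 ζ.1 (η.2.trans ζ.2.symm))
      right_inv := fun β => Subtype.ext (by
        change comp ζ.1 (inv (comp (inv β.1) ζ.1 _)) _ = β.1
        rw [comp_congr _ rfl (inv_comp_rev (inv β.1) ζ.1 _),
          comp_congr _ rfl (comp_congr _ rfl (inv_inv_eq β.1)),
          comp_inv_cancel ζ.1 β.1 (by rw [β.2, s_divFiber])]) }
  rw [← E.tsum_eq]
  refine tsum_congr fun η => ?_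
  have h1 : comp (divFiber γ ζ) (E η).1 (E η).2.symm = divFiber γ η := by
    change comp (divFiber γ ζ) (divFiber ζ η) _ = _
    have := assoc (divFiber γ ζ) ζ.1 (inv η.1) (s_divFiber γ ζ)
      (by rw [ζ.2, r_inv, η.2])
    change comp (divFiber γ ζ) (comp ζ.1 (inv η.1) _) _ = _
    rw [← this]
    exact comp_congr _ (inv_comp_cancel_right γ.1 ζ.1 (γ.2.trans ζ.2.symm)) rfl
  have h2 : inv (E η).1 = divFiber η ζ := conj_divFiber_inv ζ η
  rw [h1, h2]

theorem regularRep_mul (x : units 𝒢) (f g : Cc 𝒢) :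
    regularRep x (f * g) = regularRep x f * regularRep x g :=
  kernelOp_mul _ _ _ _ _ _ fun γ ζ => conv_divFiber x f g γ ζ

theorem regularRep_injective : Function.Injective fun (f : Cc 𝒢) (x : units 𝒢) =>
    regularRep x f := by
  classical
  intro f g h
  ext γ
  have h1 := congrFun h (sourceMap γ)
  let γ' : sourceFiber (sourceMap γ) := ⟨γ, rfl⟩
  let x' : sourceFiber (sourceMap γ) := ⟨s γ, s_s γ⟩
  have h2 : divFiber γ' x' = γ := by
    have : comp γ (inv (s γ)) (by rw [r_inv, s_s]) = γ := by
      have h3 : inv (s γ) = s γ := by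
        symm
        apply eq_inv_of_comp _ _ (by rw [s_s, r_s])
        rw [comp_congr _ rfl (s_s γ).symm, comp_id, r_s]
      rw [comp_congr _ rfl h3, comp_id]
    exact this
  have h3 := congrArg (fun T => T (lp.single 2 x' 1) γ') h1
  simp only [regularRep_single, h2] at h3
  exact h3

noncomputable instance Cc.instNonUnitalRing : NonUnitalRing (Cc 𝒢) :=
  { (inferInstance : AddCommGroup (Cc 𝒢)), (inferInstance : Mul (Cc 𝒢)) with
    left_distrib := fun a b c => regularRep_injective <| funext fun x => by
      simp only [regularRep_mul, regularRep_add, mul_add]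
    right_distrib := fun a b c => regularRep_injective <| funext fun x => by
      simp only [regularRep_mul, regularRep_add, add_mul]
    zero_mul := fun a => Cc.ext fun γ => by simp [mul_apply, zero_apply]
    mul_zero := fun a => Cc.ext fun γ => by simp [mul_apply, zero_apply]
    mul_assoc := fun a b c => regularRep_injective <| funext fun x => by
      simp only [regularRep_mul, mul_assoc] }

noncomputable instance Cc.instStarRing : StarRing (Cc 𝒢) where
  star_involutive f := Cc.ext fun γ => by simp [star_apply, inv_inv_eq]
  star_mul f g := regularRep_injective <| funext fun x => by
    simp only [regularRep_mul, regularRep_star, star_mul]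
  star_add f g := Cc.ext fun γ => by simp [star_apply, add_apply]

instance : StarModule ℂ (Cc 𝒢) where
  star_smul c f := Cc.ext fun γ => by simp [Cc.star_apply, Cc.smul_apply]

instance : IsScalarTower ℂ (Cc 𝒢) (Cc 𝒢) where
  smul_assoc c f g := regularRep_injective <| funext fun x => by
    simp only [smul_eq_mul, regularRep_mul, regularRep_smul, smul_mul_assoc]

instance : SMulCommClass ℂ (Cc 𝒢) (Cc 𝒢) where
  smul_comm c f g := regularRep_injective <| funext fun x => by
    simp only [smul_eq_mul, regularRep_mul, regularRep_smul, mul_smul_comm]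

theorem memℓp_regularRep (f : Cc 𝒢) : Memℓp (fun x : units 𝒢 => regularRep x f) ∞ :=
  memℓp_infty ⟨f.kernelBound.choose, by
    rintro _ ⟨x, rfl⟩
    exact norm_kernelOp_le _ _⟩

variable (𝒢) in
/-- The `ℓ^∞`-product `∏ₓ B(ℓ²(𝒢ₓ))`, a C*-algebra with the norm `sup_x ‖T_x‖`. -/
def RegularTarget : Type u :=
  lp (fun x : units 𝒢 => lp (fun _ : sourceFiber x => ℂ) 2 →L[ℂ]
      lp (fun _ : sourceFiber x => ℂ) 2) ∞

noncomputable instance : NonUnitalCStarAlgebra (RegularTarget 𝒢) :=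
  inferInstanceAs (NonUnitalCStarAlgebra (lp (fun x : units 𝒢 =>
    lp (fun _ : sourceFiber x => ℂ) 2 →L[ℂ] lp (fun _ : sourceFiber x => ℂ) 2) ∞))

variable (𝒢) in
/-- The *-homomorphism `f ↦ (λₓ(f))ₓ`; its norm is `sup_x ‖λₓ(f)‖`. -/
noncomputable def regularRepFamily : Cc 𝒢 →⋆ₙₐ[ℂ] RegularTarget 𝒢 where
  toFun f := ⟨fun x => regularRep x f, memℓp_regularRep f⟩
  map_smul' c f := lp.ext (funext fun x => regularRep_smul x c f)
  map_zero' := lp.ext (funext fun x => by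
    have := regularRep_smul x 0 (0 : Cc 𝒢)
    simp only [zero_smul] at this
    exact this)
  map_add' f g := lp.ext (funext fun x => regularRep_add x f g)
  map_mul' f g := lp.ext (funext fun x => regularRep_mul x f g)
  map_star' f := lp.ext (funext fun x => regularRep_star x f)

variable (𝒢) in
/-- `C*_r(𝒢)`: the completion of `C_c(𝒢)` in the norm `‖f‖ = sup_x ‖λₓ(f)‖`, realised as the closure
of the image of `C_c(𝒢)` under `f ↦ (λₓ(f))ₓ`; see `norm_toReduced`, `toReduced_injective`,
`denseRange_toReduced`. -/
def ReducedCStar : Type u :=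
  (NonUnitalStarAlgHom.range (regularRepFamily 𝒢)).topologicalClosure

noncomputable instance : NonUnitalCStarAlgebra (ReducedCStar 𝒢) :=
  have : IsClosed ((NonUnitalStarAlgHom.range (regularRepFamily 𝒢)).topologicalClosure :
    Set (RegularTarget 𝒢)) := NonUnitalStarSubalgebra.isClosed_topologicalClosure _
  inferInstanceAs (NonUnitalCStarAlgebra
    (NonUnitalStarAlgHom.range (regularRepFamily 𝒢)).topologicalClosure)

/-- The inclusion `C_c(𝒢) → C*_r(𝒢)`. -/
noncomputable def toReduced : Cc 𝒢 →⋆ₙₐ[ℂ] ReducedCStar 𝒢 :=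
  NonUnitalStarAlgHom.codRestrict (regularRepFamily 𝒢)
    (NonUnitalStarAlgHom.range (regularRepFamily 𝒢)).topologicalClosure
    fun f => NonUnitalStarSubalgebra.le_topologicalClosure _ ⟨f, rfl⟩

theorem norm_toReduced (f : Cc 𝒢) : ‖toReduced f‖ = ⨆ x : units 𝒢, ‖regularRep x f‖ := rfl

theorem bddAbove_norm_regularRep (f : Cc 𝒢) :
    BddAbove (Set.range fun x : units 𝒢 => ‖regularRep x f‖) :=
  memℓp_infty_iff.1 (memℓp_regularRep f)

theorem toReduced_injective : Function.Injective (toReduced : Cc 𝒢 → ReducedCStar 𝒢) := by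
  intro f g h
  refine regularRep_injective (funext fun x => ?_)
  exact congrArg (fun a : ReducedCStar 𝒢 => (a.1 : RegularTarget 𝒢).1 x) h

theorem denseRange_toReduced : DenseRange (toReduced : Cc 𝒢 → ReducedCStar 𝒢) := by
  intro a
  rw [Metric.mem_closure_iff]
  intro ε hε
  obtain ⟨_, ⟨f, rfl⟩, hd⟩ := Metric.mem_closure_iff.1 a.2 ε hε
  exact ⟨toReduced f, ⟨f, rfl⟩, hd⟩

end Conv

section Faithful

variable {𝒢 : Type u} [TopologicalSpace 𝒢] [Gpd 𝒢]

/-- The direct sum `⊕ₓ ℓ²(𝒢ₓ)`. -/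
abbrev SumSpace (𝒢 : Type u) [Gpd 𝒢] : Type u :=
  lp (fun x : units 𝒢 => lp (fun _ : sourceFiber x => ℂ) 2) 2

theorem sum_diag_le (T : RegularTarget 𝒢) (ξ : SumSpace 𝒢) (F : Finset (units 𝒢)) :
    ∑ x ∈ F, ‖T.1 x (ξ x)‖ ^ 2 ≤ (‖T‖ * ‖ξ‖) ^ 2 := by
  have h1 : ∑ x ∈ F, ‖ξ x‖ ^ 2 ≤ ‖ξ‖ ^ 2 := by
    simpa using lp.sum_rpow_le_norm_rpow (p := 2) (by norm_num) ξ F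
  calc _ ≤ ∑ x ∈ F, (‖T‖ * ‖ξ x‖) ^ 2 := by
        gcongr with x _
        refine ((T.1 x).le_opNorm _).trans ?_
        gcongr
        exact lp.norm_apply_le_norm ENNReal.top_ne_zero (T : lp _ ∞) x
    _ = ‖T‖ ^ 2 * ∑ x ∈ F, ‖ξ x‖ ^ 2 := by simp_rw [mul_pow]; rw [Finset.mul_sum]
    _ ≤ ‖T‖ ^ 2 * ‖ξ‖ ^ 2 := by gcongr
    _ = _ := by ring

/-- The direct sum operator `⊕ₓ Tₓ`. -/
noncomputable def diagOp (T : RegularTarget 𝒢) : SumSpace 𝒢 →L[ℂ] SumSpace 𝒢 :=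
  LinearMap.mkContinuous
    { toFun := fun ξ => ⟨fun x => T.1 x (ξ x),
        memℓp_gen' (C := (‖T‖ * ‖ξ‖) ^ 2) fun F => by simpa using sum_diag_le T ξ F⟩
      map_add' := fun ξ η => lp.ext (funext fun x => map_add (T.1 x) (ξ x) (η x))
      map_smul' := fun c ξ => lp.ext (funext fun x => map_smul (T.1 x) c (ξ x)) }
    ‖T‖ fun ξ => by
      apply lp.norm_le_of_forall_sum_le (p := 2) (by norm_num) (by positivity)
      intro F
      simpa using sum_diag_le T ξ F

theorem diagOp_apply (T : RegularTarget 𝒢) (ξ : SumSpace 𝒢) (x : units 𝒢) :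
    diagOp T ξ x = T.1 x (ξ x) := rfl

variable [IsEtale 𝒢]

variable (𝒢) in
/-- The direct sum representation `⊕ₓ λₓ` of `C*_r(𝒢)` on `⊕ₓ ℓ²(𝒢ₓ)`. -/
noncomputable def sumRep : ReducedCStar 𝒢 →⋆ₙₐ[ℂ] (SumSpace 𝒢 →L[ℂ] SumSpace 𝒢) where
  toFun a := diagOp a.1
  map_smul' _ _ := ContinuousLinearMap.ext fun _ => lp.ext rfl
  map_zero' := ContinuousLinearMap.ext fun _ => lp.ext rfl
  map_add' _ _ := ContinuousLinearMap.ext fun _ => lp.ext rfl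
  map_mul' _ _ := ContinuousLinearMap.ext fun _ => lp.ext rfl
  map_star' a := by
    rw [ContinuousLinearMap.star_eq_adjoint, ContinuousLinearMap.eq_adjoint_iff]
    intro ξ η
    rw [lp.inner_eq_tsum, lp.inner_eq_tsum]
    exact tsum_congr fun x => ContinuousLinearMap.adjoint_inner_left (a.1.1 x) (η x) (ξ x)

variable (𝒢) in
/-- `C*_r(𝒢)` has a faithful representation on a Hilbert space. -/
theorem sumRep_injective : Function.Injective (sumRep 𝒢) := by
  classical
  intro a b h
  refine Subtype.ext (lp.ext (funext fun x => ContinuousLinearMap.ext fun v => ?_))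
  let ξ : SumSpace 𝒢 := lp.single 2 x v
  have hξ : ξ x = v := lp.single_apply_self _ _ _
  have h1 : a.1.1 x (ξ x) = b.1.1 x (ξ x) :=
    congrArg (fun T : SumSpace 𝒢 →L[ℂ] SumSpace 𝒢 => T ξ x) h
  rwa [hξ] at h1

end Faithful

section Semidirect

variable {𝒢 : Type u} [TopologicalSpace 𝒢] [Gpd 𝒢]

variable (𝒢) in
/-- An automorphism of `𝒢`: a self-homeomorphism respecting the groupoid structure. -/
structure GpdAut extends 𝒢 ≃ₜ 𝒢 where
  map_r' : ∀ γ, toFun (r γ) = r (toFun γ)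
  map_s' : ∀ γ, toFun (s γ) = s (toFun γ)
  map_comp' : ∀ γ η (h : s γ = r η), toFun (comp γ η h) =
    comp (toFun γ) (toFun η) (by rw [← map_s', h, map_r'])

namespace GpdAut

instance : CoeFun (GpdAut 𝒢) fun _ => 𝒢 → 𝒢 := ⟨fun φ => φ.toFun⟩

@[ext] theorem ext {φ ψ : GpdAut 𝒢} (h : ∀ γ, φ γ = ψ γ) : φ = ψ := by
  obtain ⟨φ, _, _, _⟩ := φ
  obtain ⟨ψ, _, _, _⟩ := ψ
  congr
  exact Homeomorph.ext h

theorem map_r (φ : GpdAut 𝒢) (γ : 𝒢) : φ (r γ) = r (φ γ) := φ.map_r' γ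
theorem map_s (φ : GpdAut 𝒢) (γ : 𝒢) : φ (s γ) = s (φ γ) := φ.map_s' γ
theorem map_comp (φ : GpdAut 𝒢) (γ η : 𝒢) (h : s γ = r η) :
    φ (comp γ η h) = comp (φ γ) (φ η) (by rw [← map_s, h, map_r]) := φ.map_comp' γ η h
theorem map_inv (φ : GpdAut 𝒢) (γ : 𝒢) : φ (inv γ) = inv (φ γ) := by
  apply eq_inv_of_comp _ _ (by rw [← map_s, ← map_r, r_inv])
  rw [← map_comp _ _ _ (r_inv γ).symm, comp_inv, map_r]
theorem continuous (φ : GpdAut 𝒢) : Continuous φ := φ.toHomeomorph.continuous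

/-- `Aut(𝒢)` is a group under composition. -/
instance : Group (GpdAut 𝒢) where
  mul φ ψ :=
    { toHomeomorph := ψ.toHomeomorph.trans φ.toHomeomorph
      map_r' := fun γ => show φ (ψ (r γ)) = r (φ (ψ γ)) by rw [map_r, map_r]
      map_s' := fun γ => show φ (ψ (s γ)) = s (φ (ψ γ)) by rw [map_s, map_s]
      map_comp' := fun γ η h => by
        change φ (ψ (comp γ η h)) = comp (φ (ψ γ)) (φ (ψ η)) _
        rw [← map_comp φ _ _ (by rw [← map_s, h, map_r]), ← map_comp ψ _ _ h] }
  one :=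
    { toHomeomorph := Homeomorph.refl 𝒢
      map_r' := fun _ => rfl
      map_s' := fun _ => rfl
      map_comp' := fun _ _ _ => rfl }
  inv φ :=
    { toHomeomorph := φ.toHomeomorph.symm
      map_r' := fun γ => φ.toHomeomorph.injective (by
        change φ (φ.toHomeomorph.symm (r γ)) = φ (r (φ.toHomeomorph.symm γ))
        rw [map_r]
        change φ.toHomeomorph _ = r (φ.toHomeomorph _)
        simp)
      map_s' := fun γ => φ.toHomeomorph.injective (by
        change φ (φ.toHomeomorph.symm (s γ)) = φ (s (φ.toHomeomorph.symm γ))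
        rw [map_s]
        change φ.toHomeomorph _ = s (φ.toHomeomorph _)
        simp)
      map_comp' := fun γ η h => φ.toHomeomorph.injective (by
        change φ.toHomeomorph (φ.toHomeomorph.symm (comp γ η h)) =
          φ (comp (φ.toHomeomorph.symm γ) (φ.toHomeomorph.symm η) _)
        rw [map_comp, φ.toHomeomorph.apply_symm_apply]
        exact comp_congr _ (φ.toHomeomorph.apply_symm_apply γ).symm
          (φ.toHomeomorph.apply_symm_apply η).symm) }
  mul_assoc _ _ _ := rfl
  one_mul _ := rfl
  mul_one _ := rfl
  inv_mul_cancel φ := ext fun γ => φ.toHomeomorph.symm_apply_apply γ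

theorem mul_apply (φ ψ : GpdAut 𝒢) (γ : 𝒢) : (φ * ψ) γ = φ (ψ γ) := rfl
theorem one_apply (γ : 𝒢) : (1 : GpdAut 𝒢) γ = γ := rfl

end GpdAut

variable {G : Type v} [Group G]

/-- The right action `γ · g = α_{g⁻¹}(γ)`. -/
def rightAct (α : G →* GpdAut 𝒢) (γ : 𝒢) (g : G) : 𝒢 := α g⁻¹ γ

section
variable (α : G →* GpdAut 𝒢)

theorem rightAct_one (γ : 𝒢) : rightAct α γ 1 = γ := by
  simp only [rightAct, inv_one, map_one]; rfl
theorem rightAct_mul (γ : 𝒢) (g h : G) :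
    rightAct α γ (g * h) = rightAct α (rightAct α γ g) h := by
  simp only [rightAct, mul_inv_rev, map_mul]; rfl
theorem rightAct_r (γ : 𝒢) (g : G) : rightAct α (r γ) g = r (rightAct α γ g) := GpdAut.map_r _ _
theorem rightAct_s (γ : 𝒢) (g : G) : rightAct α (s γ) g = s (rightAct α γ g) := GpdAut.map_s _ _
theorem rightAct_inv (γ : 𝒢) (g : G) : rightAct α (inv γ) g = inv (rightAct α γ g) :=
  GpdAut.map_inv _ _
theorem rightAct_comp (γ η : 𝒢) (h : s γ = r η) (g : G) : rightAct α (comp γ η h) g =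
    comp (rightAct α γ g) (rightAct α η g) (by rw [← rightAct_s, h, rightAct_r]) :=
  GpdAut.map_comp _ _ _ _
theorem rightAct_cancel (γ : 𝒢) (g : G) : rightAct α (rightAct α γ g) g⁻¹ = γ := by
  rw [← rightAct_mul, mul_inv_cancel, rightAct_one]
theorem rightAct_cancel' (γ : 𝒢) (g : G) : rightAct α (rightAct α γ g⁻¹) g = γ := by
  rw [← rightAct_mul, inv_mul_cancel, rightAct_one]

theorem semidirect_composable {γ ξ : 𝒢} {g : G} (h : rightAct α (s γ) g = r ξ) :
    s γ = r (rightAct α ξ g⁻¹) := by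
  rw [← rightAct_r, ← h, rightAct_cancel]

end

/-- The semidirect product `𝒢 ⋊_α G`: the set `𝒢 × G`. -/
def Semidirect (_α : G →* GpdAut 𝒢) : Type (max u v) := 𝒢 × G

namespace Semidirect

variable {α : G →* GpdAut 𝒢}

variable (α) in
/-- The element `(γ, g)`. -/
def mk (γ : 𝒢) (g : G) : Semidirect α := (γ, g)

theorem ext' {p q : Semidirect α} (h1 : p.1 = q.1) (h2 : p.2 = q.2) : p = q := Prod.ext h1 h2

/-- `r(γ,g) = (r(γ),e)`, `s(γ,g) = (s(γ)·g,e)`, `(γ,g)⁻¹ = (γ⁻¹·g,g⁻¹)` and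
`(γ,g)(ξ,h) = (γ(ξ·g⁻¹),gh)`, that is, `(γ,g)(η·g,h) = (γη,gh)`. -/
instance : Gpd (Semidirect α) where
  r p := (r p.1, 1)
  s p := (rightAct α (s p.1) p.2, 1)
  inv p := (rightAct α (inv p.1) p.2, p.2⁻¹)
  comp p q h := (comp p.1 (rightAct α q.1 p.2⁻¹)
    (semidirect_composable α (congrArg Prod.fst h)), p.2 * q.2)
  r_r p := Prod.ext (r_r _) rfl
  s_r p := Prod.ext (by rw [rightAct_one]; exact s_r _) rfl
  r_s p := Prod.ext (by rw [← rightAct_r]; exact congrArg (rightAct α · p.2) (r_s _)) rfl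
  s_s p := Prod.ext (by rw [rightAct_one, ← rightAct_s]; exact congrArg (rightAct α · p.2) (s_s _)) rfl
  r_comp p q h := Prod.ext (r_comp _ _ _) rfl
  s_comp p q h := Prod.ext (by
    change rightAct α (s (comp _ _ _)) (p.2 * q.2) = rightAct α (s q.1) q.2
    rw [s_comp, rightAct_mul, rightAct_s, rightAct_cancel']) rfl
  assoc p q t h₁ h₂ := Prod.ext (by
    change comp (comp p.1 (rightAct α q.1 p.2⁻¹) _) (rightAct α t.1 (p.2 * q.2)⁻¹) _ =
      comp p.1 (rightAct α (comp q.1 (rightAct α t.1 q.2⁻¹) _) p.2⁻¹) _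
    have e : rightAct α t.1 (p.2 * q.2)⁻¹ = rightAct α (rightAct α t.1 q.2⁻¹) p.2⁻¹ := by
      rw [mul_inv_rev, rightAct_mul]
    have c₁ := semidirect_composable α (congrArg Prod.fst h₁)
    have c₂ := semidirect_composable α (congrArg Prod.fst h₂)
    rw [comp_congr _ rfl e, assoc _ _ _ c₁ (by rw [← rightAct_s, c₂, rightAct_r])]
    exact comp_congr _ rfl (rightAct_comp α _ _ _ _).symm) (mul_assoc _ _ _)
  id_comp p := Prod.ext (by
    change comp (r p.1) (rightAct α p.1 1⁻¹) _ = p.1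
    have e : rightAct α p.1 (1 : G)⁻¹ = p.1 := by rw [inv_one, rightAct_one]
    rw [comp_congr _ rfl e, id_comp]) (one_mul _)
  comp_id p := Prod.ext (by
    change comp p.1 (rightAct α (rightAct α (s p.1) p.2) p.2⁻¹) _ = p.1
    rw [comp_congr _ rfl (rightAct_cancel α (s p.1) p.2), comp_id]) (mul_one _)
  r_inv p := Prod.ext (by
    change r (rightAct α (inv p.1) p.2) = rightAct α (s p.1) p.2
    rw [← rightAct_r, r_inv]) rfl
  s_inv p := Prod.ext (by
    change rightAct α (s (rightAct α (inv p.1) p.2)) p.2⁻¹ = r p.1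
    rw [← rightAct_s, rightAct_cancel, s_inv]) rfl
  inv_comp p := Prod.ext (by
    change comp (rightAct α (inv p.1) p.2) (rightAct α p.1 p.2⁻¹⁻¹) _ = rightAct α (s p.1) p.2
    have e : rightAct α p.1 p.2⁻¹⁻¹ = rightAct α p.1 p.2 := by rw [inv_inv]
    rw [comp_congr _ rfl e, ← rightAct_comp _ _ _ (s_inv p.1), inv_comp]) (inv_mul_cancel _)
  comp_inv p := Prod.ext (by
    change comp p.1 (rightAct α (rightAct α (inv p.1) p.2) p.2⁻¹) _ = r p.1
    rw [comp_congr _ rfl (rightAct_cancel α (inv p.1) p.2), comp_inv]) (mul_inv_cancel _)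

variable [TopologicalSpace G]

/-- The product topology. -/
instance : TopologicalSpace (Semidirect α) := inferInstanceAs (TopologicalSpace (𝒢 × G))

theorem continuous_fst' : Continuous fun p : Semidirect α => p.1 :=
  continuous_fst (X := 𝒢) (Y := G)
theorem continuous_snd' : Continuous fun p : Semidirect α => p.2 :=
  continuous_snd (X := 𝒢) (Y := G)

theorem continuous_inv_aux [DiscreteTopology G] [IsEtale 𝒢] :
    Continuous (inv : Semidirect α → Semidirect α) := by
  refine Continuous.prodMk ?_ ?_
  · change Continuous fun p : 𝒢 × G => rightAct α (inv p.1) p.2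
    rw [continuous_prod_of_discrete_right]
    exact fun g => (GpdAut.continuous (α g⁻¹)).comp IsEtale.continuous_inv
  · exact (continuous_of_discreteTopology (f := fun g : G => g⁻¹)).comp continuous_snd

theorem isLocalHomeomorph_fst [DiscreteTopology G] :
    IsLocalHomeomorph (Prod.fst : 𝒢 × G → 𝒢) := by
  rw [isLocalHomeomorph_iff_isOpenEmbedding_restrict]
  intro p
  refine ⟨Set.univ ×ˢ {p.2}, (isOpen_univ.prod (isOpen_discrete _)).mem_nhds (by simp), ?_⟩
  refine Topology.IsOpenEmbedding.of_continuous_injective_isOpenMap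
    (continuous_fst.comp continuous_subtype_val) ?_ ?_
  · rintro ⟨⟨a, b⟩, _, hb⟩ ⟨⟨a', b'⟩, _, hb'⟩ h
    have ha : a = a' := h
    exact Subtype.ext (Prod.ext ha (hb.trans hb'.symm))
  · exact isOpenMap_fst.comp (isOpen_univ.prod (isOpen_discrete _)).isOpenMap_subtype_val

theorem isLocalHomeomorph_rangeMap [DiscreteTopology G] [IsEtale 𝒢] :
    IsLocalHomeomorph (rangeMap : Semidirect α → units (Semidirect α)) := by
  let h : units 𝒢 ≃ₜ units (Semidirect α) :=
    { toFun := fun x => ⟨(x.1, 1), Prod.ext x.2 rfl⟩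
      invFun := fun y => ⟨y.1.1, congrArg Prod.fst y.2⟩
      left_inv := fun _ => rfl
      right_inv := fun y => by
        have h2 : (1 : G) = y.1.2 := congrArg Prod.snd (show r y.1 = y.1 from y.2)
        exact Subtype.ext (Prod.ext rfl h2)
      continuous_toFun := Continuous.subtype_mk (f := fun x : units 𝒢 => ((x.1, 1) : 𝒢 × G))
        (Continuous.prodMk continuous_subtype_val continuous_const) _
      continuous_invFun := Continuous.subtype_mk (f := fun y : units (Semidirect α) => y.1.1)
        (continuous_fst'.comp continuous_subtype_val) _ }
  exact h.isLocalHomeomorph.comp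
    ((IsEtale.isLocalHomeomorph_range (𝒢 := 𝒢)).comp isLocalHomeomorph_fst)

/-- The semidirect product of an étale groupoid by a countable discrete group is étale. -/
instance [DiscreteTopology G] [Countable G] [IsEtale 𝒢] : IsEtale (Semidirect α) where
  continuous_inv := continuous_inv_aux
  continuous_comp := by
    let P := {p : Semidirect α × Semidirect α // s p.1 = r p.2}
    have c₁ : Continuous fun p : P => p.1.1 := continuous_fst.comp continuous_subtype_val
    have c₂ : Continuous fun p : P => p.1.2 := continuous_snd.comp continuous_subtype_val
    have h1 : Continuous fun p : 𝒢 × G => rightAct α p.1 p.2⁻¹ := by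
      rw [continuous_prod_of_discrete_right]
      exact fun g => GpdAut.continuous (α g⁻¹⁻¹)
    have h2 : Continuous fun p : P => rightAct α p.1.2.1 p.1.1.2⁻¹ :=
      h1.comp (Continuous.prodMk (continuous_fst'.comp c₂) (continuous_snd'.comp c₁))
    have h3 : Continuous fun p : P => comp p.1.1.1 (rightAct α p.1.2.1 p.1.1.2⁻¹)
        (semidirect_composable α (congrArg Prod.fst p.2)) :=
      IsEtale.continuous_comp.comp (Continuous.subtype_mk
        (Continuous.prodMk (continuous_fst'.comp c₁) h2)
        fun p => semidirect_composable α (congrArg Prod.fst p.2))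
    have h4 : Continuous fun p : P => p.1.1.2 * p.1.2.2 :=
      (continuous_of_discreteTopology (f := fun q : G × G => q.1 * q.2)).comp
        (Continuous.prodMk (continuous_snd'.comp c₁) (continuous_snd'.comp c₂))
    exact Continuous.prodMk h3 h4
  locallyCompact := by
    have : LocallyCompactSpace 𝒢 := IsEtale.locallyCompact
    exact inferInstanceAs (LocallyCompactSpace (𝒢 × G))
  t2 := by
    have : T2Space 𝒢 := IsEtale.t2
    exact inferInstanceAs (T2Space (𝒢 × G))
  secondCountable := by
    have : SecondCountableTopology 𝒢 := IsEtale.secondCountable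
    exact inferInstanceAs (SecondCountableTopology (𝒢 × G))
  isLocalHomeomorph_range := isLocalHomeomorph_rangeMap
  isLocalHomeomorph_source := by
    let i : Semidirect α ≃ₜ Semidirect α :=
      { toFun := inv, invFun := inv, left_inv := inv_inv_eq, right_inv := inv_inv_eq
        continuous_toFun := continuous_inv_aux
        continuous_invFun := continuous_inv_aux }
    have h : (sourceMap : Semidirect α → units (Semidirect α)) = rangeMap ∘ i := by
      funext p
      exact Subtype.ext (r_inv p).symm
    rw [h]
    exact isLocalHomeomorph_rangeMap.comp i.isLocalHomeomorph

end Semidirect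
end Semidirect


section CrossedProduct

variable {A : Type u} [NonUnitalCStarAlgebra A] {G : Type v} [Group G]

/-- The *-algebra `AG` of finite sums `∑ a_g δ_g`, with `(a δ_g)(b δ_h) = a α_g(b) δ_{gh}` and
`(a δ_g)* = α_{g⁻¹}(a*) δ_{g⁻¹}`. -/
def CrossedAlg (_α : G →* (A ≃⋆ₐ[ℂ] A)) : Type (max u v) := G →₀ A

namespace CrossedAlg
variable {α : G →* (A ≃⋆ₐ[ℂ] A)}

noncomputable instance : AddCommGroup (CrossedAlg α) := inferInstanceAs (AddCommGroup (G →₀ A))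
noncomputable instance : Module ℂ (CrossedAlg α) := inferInstanceAs (Module ℂ (G →₀ A))

variable (α) in
/-- The element `a δ_g`. -/
noncomputable def single (g : G) (a : A) : CrossedAlg α := Finsupp.single g a

theorem single_add (g : G) (a b : A) : single α g (a + b) = single α g a + single α g b :=
  Finsupp.single_add _ _ _
theorem single_zero (g : G) : single α g 0 = 0 := Finsupp.single_zero _
theorem smul_single (c : ℂ) (g : G) (a : A) : c • single α g a = single α g (c • a) :=
  Finsupp.smul_single _ _ _

theorem induction {p : CrossedAlg α → Prop} (x : CrossedAlg α) (h0 : p 0)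
    (hadd : ∀ x y, p x → p y → p (x + y)) (hs : ∀ g a, p (single α g a)) : p x :=
  Finsupp.induction_linear x h0 hadd hs

noncomputable instance : Mul (CrossedAlg α) where
  mul x y := Finsupp.sum x fun g a => Finsupp.sum y fun h b => single α (g * h) (a * α g b)

noncomputable instance : Star (CrossedAlg α) where
  star x := Finsupp.sum x fun g a => single α g⁻¹ (α g⁻¹ (star a))

theorem mul_def (x y : CrossedAlg α) : x * y =
  Finsupp.sum x fun g a => Finsupp.sum y fun h b => single α (g * h) (a * α g b) := rfl
theorem star_def (x : CrossedAlg α) : star x =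
  Finsupp.sum x fun g a => single α g⁻¹ (α g⁻¹ (star a)) := rfl

theorem single_mul_single (g h : G) (a b : A) :
    single α g a * single α h b = single α (g * h) (a * α g b) := by
  rw [mul_def]
  refine (Finsupp.sum_single_index ?_).trans (Finsupp.sum_single_index ?_)
  · simp only [zero_mul, single_zero]; exact Finset.sum_const_zero
  · simp only [map_zero, mul_zero, single_zero]

theorem star_single (g : G) (a : A) : star (single α g a) = single α g⁻¹ (α g⁻¹ (star a)) := by
  rw [star_def]
  exact Finsupp.sum_single_index (by simp only [star_zero, map_zero, single_zero])

theorem add_mul' (x y z : CrossedAlg α) : (x + y) * z = x * z + y * z := by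
  classical
  refine Finsupp.sum_add_index (fun g _ => ?_) fun g _ a b => ?_
  · simp only [zero_mul, single_zero]; exact Finset.sum_const_zero
  · simp only [add_mul, single_add]; exact Finsupp.sum_add

theorem mul_add' (x y z : CrossedAlg α) : x * (y + z) = x * y + x * z := by
  classical
  simp only [mul_def]
  refine Eq.trans (Finset.sum_congr rfl fun g _ => ?_) Finsupp.sum_add
  refine Finsupp.sum_add_index (fun h _ => ?_) fun h _ a b => ?_
  · simp only [map_zero, mul_zero, single_zero]
  · simp only [map_add, mul_add, single_add]

theorem zero_mul' (x : CrossedAlg α) : 0 * x = 0 := Finsupp.sum_zero_index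
theorem mul_zero' (x : CrossedAlg α) : x * 0 = 0 := by
  rw [mul_def]; exact Finset.sum_const_zero

theorem star_add' (x y : CrossedAlg α) : star (x + y) = star x + star y := by
  classical
  refine Finsupp.sum_add_index (fun g _ => ?_) fun g _ a b => ?_
  · simp only [star_zero, map_zero, single_zero]
  · simp only [star_add, map_add, single_add]

theorem star_zero' : star (0 : CrossedAlg α) = 0 := Finsupp.sum_zero_index

theorem act_mul (g h : G) (a : A) : α (g * h) a = α g (α h a) := by rw [map_mul]; rfl
theorem act_one (a : A) : α 1 a = a := by rw [map_one]; rfl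

noncomputable instance : NonUnitalRing (CrossedAlg α) :=
  { (inferInstance : AddCommGroup (CrossedAlg α)), (inferInstance : Mul (CrossedAlg α)) with
    left_distrib := mul_add'
    right_distrib := add_mul'
    zero_mul := zero_mul'
    mul_zero := mul_zero'
    mul_assoc := fun x y z => by
      induction x using induction with
      | h0 => simp only [zero_mul']
      | hadd x x' h h' => simp only [add_mul', h, h']
      | hs g a =>
        induction y using induction with
        | h0 => simp only [zero_mul', mul_zero']
        | hadd y y' h h' => simp only [add_mul', mul_add', h, h']
        | hs h b =>
          induction z using induction with
          | h0 => simp only [mul_zero']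
          | hadd z z' h h' => simp only [mul_add', h, h']
          | hs k c => simp only [single_mul_single, mul_assoc, map_mul]; rfl }

noncomputable instance : StarRing (CrossedAlg α) where
  star_involutive x := by
    induction x using induction with
    | h0 => simp only [star_zero']
    | hadd x y h h' => simp only [star_add', h, h']
    | hs g a => rw [star_single, star_single, ← map_star, star_star, ← act_mul, inv_inv,
        mul_inv_cancel, act_one]
  star_mul x y := by
    induction x using induction with
    | h0 => simp only [star_zero', zero_mul', mul_zero']
    | hadd x x' h h' => simp only [star_add', add_mul', mul_add', h, h']
    | hs g a =>
      induction y using induction with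
      | h0 => simp only [star_zero', zero_mul', mul_zero']
      | hadd y y' h h' => simp only [star_add', add_mul', mul_add', h, h']
      | hs h b =>
        simp only [star_single, single_mul_single, star_mul, mul_inv_rev, map_mul, ← map_star]
        simp only [← act_mul, ← map_mul, mul_assoc, inv_mul_cancel, mul_one]
  star_add := star_add'

instance : StarModule ℂ (CrossedAlg α) where
  star_smul c x := by
    induction x using induction with
    | h0 => simp only [smul_zero, star_zero']
    | hadd x y h h' => simp only [smul_add, star_add', h, h']
    | hs g a => simp only [smul_single, star_single, star_smul, map_smul]

instance : IsScalarTower ℂ (CrossedAlg α) (CrossedAlg α) where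
  smul_assoc c x y := by
    simp only [smul_eq_mul]
    induction x using induction with
    | h0 => simp only [smul_zero, zero_mul']
    | hadd x x' h h' => simp only [smul_add, add_mul', h, h']
    | hs g a =>
      induction y using induction with
      | h0 => simp only [smul_zero, mul_zero']
      | hadd y y' h h' => simp only [smul_add, mul_add', h, h']
      | hs h b => simp only [smul_single, single_mul_single, smul_mul_assoc]

instance : SMulCommClass ℂ (CrossedAlg α) (CrossedAlg α) where
  smul_comm c x y := by
    simp only [smul_eq_mul]
    induction x using induction with
    | h0 => simp only [smul_zero, zero_mul']
    | hadd x x' h h' => simp only [smul_add, add_mul', h, h']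
    | hs g a =>
      induction y using induction with
      | h0 => simp only [smul_zero, mul_zero']
      | hadd y y' h h' => simp only [smul_add, mul_add', h, h']
      | hs h b => simp only [smul_single, single_mul_single, map_smul, mul_smul_comm]

end CrossedAlg

variable {H : Type w} [NormedAddCommGroup H] [InnerProductSpace ℂ H] [CompleteSpace H]
  (α : G →* (A ≃⋆ₐ[ℂ] A)) (ρ : A →⋆ₙₐ[ℂ] (H →L[ℂ] H))

theorem norm_act_le (g : G) (a : A) : ‖ρ (α g a)‖ ≤ ‖a‖ :=
  (NonUnitalStarAlgHom.norm_apply_le ρ _).trans (NonUnitalStarAlgHom.norm_apply_le (α g) _)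

theorem sum_inducedRep_le (a : A) (ξ : lp (fun _ : G => H) 2) (F : Finset G) :
    ∑ g ∈ F, ‖ρ (α g⁻¹ a) (ξ g)‖ ^ 2 ≤ (‖a‖ * ‖ξ‖) ^ 2 := by
  have h1 : ∑ g ∈ F, ‖ξ g‖ ^ 2 ≤ ‖ξ‖ ^ 2 := by
    simpa using lp.sum_rpow_le_norm_rpow (p := 2) (by norm_num) ξ F
  calc _ ≤ ∑ g ∈ F, (‖a‖ * ‖ξ g‖) ^ 2 := by
        gcongr with g _
        exact ((ρ (α g⁻¹ a)).le_opNorm _).trans (by gcongr; exact norm_act_le α ρ _ _)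
    _ = ‖a‖ ^ 2 * ∑ g ∈ F, ‖ξ g‖ ^ 2 := by simp_rw [mul_pow]; rw [Finset.mul_sum]
    _ ≤ ‖a‖ ^ 2 * ‖ξ‖ ^ 2 := by gcongr
    _ = _ := by ring

/-- `ρ̃(a) ξ (g) = ρ(α_g⁻¹(a)) (ξ(g))` on `ℓ²(G, H)`. -/
noncomputable def inducedRep (a : A) : lp (fun _ : G => H) 2 →L[ℂ] lp (fun _ : G => H) 2 :=
  LinearMap.mkContinuous
    { toFun := fun ξ => ⟨fun g => ρ (α g⁻¹ a) (ξ g),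
        memℓp_gen' (C := (‖a‖ * ‖ξ‖) ^ 2) fun F => by simpa using sum_inducedRep_le α ρ a ξ F⟩
      map_add' := fun ξ η => lp.ext (funext fun g => map_add (ρ (α g⁻¹ a)) (ξ g) (η g))
      map_smul' := fun c ξ => lp.ext (funext fun g => map_smul (ρ (α g⁻¹ a)) c (ξ g)) }
    ‖a‖ fun ξ => by
      apply lp.norm_le_of_forall_sum_le (p := 2) (by norm_num) (by positivity)
      intro F
      simpa using sum_inducedRep_le α ρ a ξ F

variable (H) in
theorem sum_translation_le (h : G) (ξ : lp (fun _ : G => H) 2) (F : Finset G) :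
    ∑ g ∈ F, ‖ξ (h⁻¹ * g)‖ ^ 2 ≤ ‖ξ‖ ^ 2 := by
  classical
  have h1 := lp.sum_rpow_le_norm_rpow (p := 2) (by norm_num) ξ (F.image (h⁻¹ * ·))
  rw [Finset.sum_image (mul_right_injective h⁻¹).injOn] at h1
  simpa using h1

variable (H) in
/-- The left regular representation, `u_h ξ (g) = ξ(h⁻¹ g)` on `ℓ²(G, H)`. -/
noncomputable def leftTranslation (h : G) :
    lp (fun _ : G => H) 2 →L[ℂ] lp (fun _ : G => H) 2 :=
  LinearMap.mkContinuous
    { toFun := fun ξ => ⟨fun g => ξ (h⁻¹ * g),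
        memℓp_gen' (C := ‖ξ‖ ^ 2) fun F => by simpa using sum_translation_le H h ξ F⟩
      map_add' := fun ξ η => lp.ext (funext fun g => rfl)
      map_smul' := fun c ξ => lp.ext (funext fun g => rfl) }
    1 fun ξ => by
      rw [one_mul]
      apply lp.norm_le_of_forall_sum_le (p := 2) (by norm_num) (norm_nonneg _)
      intro F
      simpa using sum_translation_le H h ξ F

theorem inducedRep_apply (a : A) (ξ : lp (fun _ : G => H) 2) (g : G) :
    inducedRep α ρ a ξ g = ρ (α g⁻¹ a) (ξ g) := rfl
theorem leftTranslation_apply (h : G) (ξ : lp (fun _ : G => H) 2) (g : G) :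
    leftTranslation H h ξ g = ξ (h⁻¹ * g) := rfl

theorem op_ext {S T : lp (fun _ : G => H) 2 →L[ℂ] lp (fun _ : G => H) 2}
    (h : ∀ ξ g, S ξ g = T ξ g) : S = T :=
  ContinuousLinearMap.ext fun ξ => lp.ext (funext (h ξ))

theorem inducedRep_add (a b : A) :
    inducedRep α ρ (a + b) = inducedRep α ρ a + inducedRep α ρ b :=
  op_ext fun ξ g => by
    rw [add_apply, lp.coeFn_add, Pi.add_apply]
    simp only [inducedRep_apply, map_add, add_apply]

theorem inducedRep_smul (c : ℂ) (a : A) : inducedRep α ρ (c • a) = c • inducedRep α ρ a :=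
  op_ext fun ξ g => by
    rw [smul_apply, lp.coeFn_smul, Pi.smul_apply]
    simp only [inducedRep_apply, map_smul, smul_apply]

theorem inducedRep_zero : inducedRep α ρ 0 = 0 := by
  simpa using inducedRep_smul α ρ 0 0

theorem inducedRep_mul (a b : A) : inducedRep α ρ (a * b) = inducedRep α ρ a * inducedRep α ρ b :=
  op_ext fun ξ g => by
    simp only [mul_apply_eq_comp, inducedRep_apply, map_mul]

theorem inducedRep_star (a : A) : inducedRep α ρ (star a) = star (inducedRep α ρ a) := by
  rw [ContinuousLinearMap.star_eq_adjoint, ContinuousLinearMap.eq_adjoint_iff]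
  intro ξ η
  rw [lp.inner_eq_tsum, lp.inner_eq_tsum]
  refine tsum_congr fun g => ?_
  rw [inducedRep_apply, inducedRep_apply, map_star, map_star,
    ContinuousLinearMap.star_eq_adjoint, ContinuousLinearMap.adjoint_inner_left]

theorem leftTranslation_mul (g h : G) :
    leftTranslation H (g * h) = leftTranslation H g * leftTranslation H h :=
  op_ext fun ξ k => by
    simp only [mul_apply_eq_comp, leftTranslation_apply, mul_inv_rev, mul_assoc]

theorem leftTranslation_star (g : G) :
    leftTranslation H g⁻¹ = star (leftTranslation H g) := by
  rw [ContinuousLinearMap.star_eq_adjoint, ContinuousLinearMap.eq_adjoint_iff]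
  intro ξ η
  rw [lp.inner_eq_tsum, lp.inner_eq_tsum, ← (Equiv.mulLeft g).tsum_eq fun k =>
    inner ℂ (ξ k) (leftTranslation H g η k)]
  refine tsum_congr fun k => ?_
  simp [leftTranslation_apply]

theorem leftTranslation_mul_inducedRep (g : G) (a : A) :
    leftTranslation H g * inducedRep α ρ a = inducedRep α ρ (α g a) * leftTranslation H g :=
  op_ext fun ξ k => by
    simp only [mul_apply_eq_comp, leftTranslation_apply, inducedRep_apply, mul_inv_rev, inv_inv,
      CrossedAlg.act_mul]

/-- `∑ a_g δ_g ↦ ∑ ρ̃(a_g) u_g`. -/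
noncomputable def crossedRepFun (x : CrossedAlg α) :
    lp (fun _ : G => H) 2 →L[ℂ] lp (fun _ : G => H) 2 :=
  Finsupp.sum x fun g a => inducedRep α ρ a * leftTranslation H g

theorem crossedRepFun_single (g : G) (a : A) : crossedRepFun α ρ (CrossedAlg.single α g a) =
    inducedRep α ρ a * leftTranslation H g :=
  Finsupp.sum_single_index (by rw [inducedRep_zero, zero_mul])

theorem crossedRepFun_zero : crossedRepFun α ρ 0 = 0 := Finsupp.sum_zero_index

theorem crossedRepFun_add (x y : CrossedAlg α) :
    crossedRepFun α ρ (x + y) = crossedRepFun α ρ x + crossedRepFun α ρ y := by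
  classical
  refine Finsupp.sum_add_index (fun g _ => ?_) fun g _ a b => ?_
  · rw [inducedRep_zero, zero_mul]
  · rw [inducedRep_add, add_mul]

/-- The representation `ρ̃ ⋊ u : ∑ a_g δ_g ↦ ∑ ρ̃(a_g) u_g` of `AG` on `ℓ²(G, H)`. -/
noncomputable def crossedRep :
    CrossedAlg α →⋆ₙₐ[ℂ] (lp (fun _ : G => H) 2 →L[ℂ] lp (fun _ : G => H) 2) where
  toFun := crossedRepFun α ρ
  map_zero' := crossedRepFun_zero α ρ
  map_add' := crossedRepFun_add α ρ
  map_smul' c x := by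
    induction x using CrossedAlg.induction with
    | h0 => simp [crossedRepFun_zero]
    | hadd x y h h' => simp only [smul_add, crossedRepFun_add, h, h']
    | hs g a =>
      simp only [CrossedAlg.smul_single, crossedRepFun_single, inducedRep_smul, smul_mul_assoc]
      rfl
  map_mul' x y := by
    induction x using CrossedAlg.induction with
    | h0 => simp [crossedRepFun_zero]
    | hadd x x' h h' => simp only [add_mul, crossedRepFun_add, h, h']
    | hs g a =>
      induction y using CrossedAlg.induction with
      | h0 => simp [crossedRepFun_zero]
      | hadd y y' h h' => simp only [mul_add, crossedRepFun_add, h, h']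
      | hs h b =>
        rw [CrossedAlg.single_mul_single, crossedRepFun_single, crossedRepFun_single,
          crossedRepFun_single, inducedRep_mul, leftTranslation_mul, mul_assoc, mul_assoc,
          ← mul_assoc (leftTranslation H g), leftTranslation_mul_inducedRep, mul_assoc]
  map_star' x := by
    induction x using CrossedAlg.induction with
    | h0 => simp [crossedRepFun_zero]
    | hadd x y h h' => simp only [star_add, crossedRepFun_add, h, h']
    | hs g a =>
      rw [CrossedAlg.star_single, crossedRepFun_single, crossedRepFun_single, star_mul,
        ← leftTranslation_star, ← inducedRep_star, leftTranslation_mul_inducedRep]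

/-- The reduced crossed product `A ⋊_{α,r} G`, formed with the (faithful) representation `ρ` of `A`:
the completion of `AG` in the norm `‖(ρ̃ ⋊ u)(x)‖`, realised as the closure of `(ρ̃ ⋊ u)(AG)`. -/
def ReducedCrossedProduct : Type (max v w) :=
  (NonUnitalStarAlgHom.range (crossedRep α ρ)).topologicalClosure

noncomputable instance : NonUnitalCStarAlgebra (ReducedCrossedProduct α ρ) :=
  have : IsClosed ((NonUnitalStarAlgHom.range (crossedRep α ρ)).topologicalClosure :
    Set (lp (fun _ : G => H) 2 →L[ℂ] lp (fun _ : G => H) 2)) :=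
    NonUnitalStarSubalgebra.isClosed_topologicalClosure _
  inferInstanceAs (NonUnitalCStarAlgebra
    (NonUnitalStarAlgHom.range (crossedRep α ρ)).topologicalClosure)

/-- The canonical map `AG → A ⋊_{α,r} G`. -/
noncomputable def toCrossed : CrossedAlg α →⋆ₙₐ[ℂ] ReducedCrossedProduct α ρ :=
  NonUnitalStarAlgHom.codRestrict (crossedRep α ρ)
    (NonUnitalStarAlgHom.range (crossedRep α ρ)).topologicalClosure
    fun f => NonUnitalStarSubalgebra.le_topologicalClosure _ ⟨f, rfl⟩

theorem norm_toCrossed (x : CrossedAlg α) : ‖toCrossed α ρ x‖ = ‖crossedRep α ρ x‖ := rfl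

theorem denseRange_toCrossed : DenseRange (toCrossed α ρ) := by
  intro a
  rw [Metric.mem_closure_iff]
  intro ε hε
  obtain ⟨_, ⟨f, rfl⟩, hd⟩ := Metric.mem_closure_iff.1 a.2 ε hε
  exact ⟨toCrossed α ρ f, ⟨f, rfl⟩, hd⟩

end CrossedProduct

end EtaleGpd

open EtaleGpd

/-! For (1), an automorphism `φ` of `𝒢` maps the source fibre over `x` bijectively onto the one over
`φ x`, and `φ(γη⁻¹) = φ(γ)φ(η)⁻¹`. The resulting unitary between the ℓ²-spaces carries `λ_{φ(x)}(f)`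
to `λ_x(f ∘ φ)`. Hence `f ↦ f ∘ φ` preserves the reduced norm and extends to the completion
(`norm_regularRep_compAut`, `exists_reducedAction`).

For (2), write `A = C*_r(𝒢)`. The map `(γ, g) ↦ (g, γ · g)` identifies the source fibre of `𝒢 ⋊ G`
over `(x, e)` with `G × 𝒢ₓ`. Under this identification, the representation of `AG` on `ℓ²(G,
ℓ²(𝒢ₓ))` induced by `λₓ` sends `f δ_h` to the regular representation of the function equal to `f` on
`𝒢 × {h}` and zero elsewhere (`fiberRep_single`). Thus the norm on `C_c(𝒢 ⋊ G)` is the supremum over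
`x` of the norms in the representations of `AG` induced by the `λₓ`.

What remains is that this supremum is the crossed product norm formed with any faithful `ρ`
(`norm_crossedRep_le_of_jointly_faithful`). An induced operator has as its norm the supremum of the
norms of its compressions to finite subsets `F` of `G`. Such a compression is the image of a matrix
over `A` that does not depend on the representation. A jointly faithful family of representations of
`A` is jointly faithful on `M_F(A)`, hence determines the norm there, because injective
*-homomorphisms of C*-algebras are isometric.

Both algebras are then completions of `AG` for the same seminorm: every element of `C_c(𝒢 ⋊ G)` is a
finite sum of functions supported on single slices, so the image of `AG` is dense. A general
completion argument (`exists_starAlgEquiv_of_norm_eq`) gives `Φ`. -/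

namespace EtaleGpd

open scoped ENNReal ComplexConjugate
open Gpd

/-! ### Isometry and completion principles for C*-algebras. -/

section CStar

/-- The maps `φ i` assemble into one *-homomorphism to the ℓ^∞-product of the `B i`. Joint
injectivity makes it injective, hence isometric, so the norm of `m` is the supremum of the `‖φ i
m‖`. -/
theorem norm_le_of_jointly_injective {M : Type*} [NonUnitalCStarAlgebra M] {ι : Type*}
    {B : ι → Type*} [∀ i, NonUnitalCStarAlgebra (B i)] (φ : ∀ i, M →⋆ₙₐ[ℂ] B i)
    (hφ : ∀ m, (∀ i, φ i m = 0) → m = 0) {m : M} {C : ℝ} (hC : 0 ≤ C)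
    (h : ∀ i, ‖φ i m‖ ≤ C) : ‖m‖ ≤ C := by
  let Ψ : M →⋆ₙₐ[ℂ] lp B ∞ :=
    { toFun := fun m => ⟨fun i => φ i m, memℓp_infty ⟨‖m‖, by
        rintro _ ⟨i, rfl⟩
        exact NonUnitalStarAlgHom.norm_apply_le (φ i) m⟩⟩
      map_smul' := fun c m => lp.ext (funext fun i => map_smul (φ i) c m)
      map_zero' := lp.ext (funext fun i => map_zero (φ i))
      map_add' := fun m n => lp.ext (funext fun i => map_add (φ i) m n)
      map_mul' := fun m n => lp.ext (funext fun i => map_mul (φ i) m n)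
      map_star' := fun m => lp.ext (funext fun i => map_star (φ i) m) }
  have hΨ : Function.Injective Ψ := (injective_iff_map_eq_zero Ψ).2 fun m hm =>
    hφ m fun i => congrFun (congrArg (fun a : lp B ∞ => (a : ∀ i, B i)) hm) i
  rw [← NonUnitalStarAlgHom.norm_map Ψ hΨ m]
  exact lp.norm_le_of_forall_le hC h

/-- The isomorphism is the closure `D` of the set of pairs `(i x, j x)` in `A × B`, read as a graph.
The identity `‖a‖ = ‖b‖` passes to the closure, so both coordinate projections of `D` are injective.
No norm or completion of `R` itself is needed. -/
theorem exists_starAlgEquiv_of_norm_eq {R A B : Type*} [NonUnitalNonAssocSemiring R] [Star R]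
    [Module ℂ R] [NonUnitalCStarAlgebra A] [NonUnitalCStarAlgebra B]
    (i : R →⋆ₙₐ[ℂ] A) (j : R →⋆ₙₐ[ℂ] B) (hi : DenseRange i) (hj : DenseRange j)
    (hij : ∀ x, ‖i x‖ = ‖j x‖) : ∃ Φ : A ≃⋆ₐ[ℂ] B, ∀ x, Φ (i x) = j x := by
  let D := (NonUnitalStarAlgHom.range (i.prod j)).topologicalClosure
  have hDc : IsClosed (D : Set (A × B)) := NonUnitalStarSubalgebra.isClosed_topologicalClosure _
  let _ : NonUnitalCStarAlgebra D := inferInstance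
  have hnorm : ∀ d ∈ D, ‖d.1‖ = ‖d.2‖ := by
    have : IsClosed {d : A × B | ‖d.1‖ = ‖d.2‖} :=
      isClosed_eq continuous_fst.norm continuous_snd.norm
    exact fun d hd => closure_minimal (by rintro _ ⟨x, rfl⟩; exact hij x) this hd
  have hmem : ∀ x, (i x, j x) ∈ D := fun x =>
    NonUnitalStarSubalgebra.le_topologicalClosure _ ⟨x, rfl⟩
  let p : D →⋆ₙₐ[ℂ] A :=
    (NonUnitalStarAlgHom.fst ℂ A B).comp (NonUnitalStarSubalgebraClass.subtype D)
  let q : D →⋆ₙₐ[ℂ] B :=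
    (NonUnitalStarAlgHom.snd ℂ A B).comp (NonUnitalStarSubalgebraClass.subtype D)
  have hp : Function.Injective p := (injective_iff_map_eq_zero p).2 fun d hd => by
    have h1 : d.1.1 = 0 := hd
    have h2 := hnorm d.1 d.2
    rw [h1, norm_zero, eq_comm, norm_eq_zero] at h2
    exact Subtype.ext (Prod.ext h1 h2)
  have hq : Function.Injective q := (injective_iff_map_eq_zero q).2 fun d hd => by
    have h1 : d.1.2 = 0 := hd
    have h2 := hnorm d.1 d.2
    rw [h1, norm_zero, norm_eq_zero] at h2
    exact Subtype.ext (Prod.ext h2 h1)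
  -- An injective *-homomorphism is isometric, so its range is closed; this range contains the dense
  -- range of `i`.
  have hps : Function.Surjective p := by
    rw [← Set.range_eq_univ,
      ← (NonUnitalStarAlgHom.isometry p hp).isClosedEmbedding.isClosed_range.closure_eq]
    exact (hi.mono (by rintro _ ⟨x, rfl⟩; exact ⟨⟨_, hmem x⟩, rfl⟩)).closure_eq
  have hqs : Function.Surjective q := by
    rw [← Set.range_eq_univ,
      ← (NonUnitalStarAlgHom.isometry q hq).isClosedEmbedding.isClosed_range.closure_eq]
    exact (hj.mono (by rintro _ ⟨x, rfl⟩; exact ⟨⟨_, hmem x⟩, rfl⟩)).closure_eq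
  let P := StarAlgEquiv.ofBijective p ⟨hp, hps⟩
  let Q := StarAlgEquiv.ofBijective q ⟨hq, hqs⟩
  refine ⟨P.symm.trans Q, fun x => ?_⟩
  have : P.symm (i x) = ⟨_, hmem x⟩ := P.injective (P.apply_symm_apply _)
  rw [StarAlgEquiv.trans_apply, this]
  rfl

end CStar

/-! ### Finite matrices over `A` acting on `ℓ²(G, H)`, and truncation to finite subsets of `G`. -/

section Truncation

variable {G : Type v} {H : Type w} [NormedAddCommGroup H] [InnerProductSpace ℂ H] [CompleteSpace H]

open Classical in
/-- The operator on `ℓ²(G, H)` with the single nonzero matrix entry `T` in position `(k, l)`. -/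
noncomputable def entryOp (k l : G) (T : H →L[ℂ] H) :
    lp (fun _ : G => H) 2 →L[ℂ] lp (fun _ : G => H) 2 :=
  (lp.singleContinuousLinearMap ℂ (fun _ : G => H) 2 k).comp
    (T.comp (lp.evalCLM ℂ (fun _ : G => H) 2 l))

open Classical in
theorem entryOp_apply (k l : G) (T : H →L[ℂ] H) (ξ : lp (fun _ : G => H) 2) (g : G) :
    entryOp k l T ξ g = if g = k then T (ξ l) else 0 := by
  change lp.single (E := fun _ : G => H) 2 k (T (ξ l)) g = _
  rw [lp.single_apply, Pi.single_apply]

variable {A : Type u} [NonUnitalCStarAlgebra A] (F : Finset G)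

/-- The operator on `ℓ²(G, H)` given by a finite matrix over `A`, represented through `ρ`. -/
noncomputable def matrixOp (ρ : A →⋆ₙₐ[ℂ] (H →L[ℂ] H)) (m : CStarMatrix F F A) :
    lp (fun _ : G => H) 2 →L[ℂ] lp (fun _ : G => H) 2 :=
  ∑ k : F, ∑ l : F, entryOp k.1 l.1 (ρ (m k l))

theorem matrixOp_apply_mem (ρ : A →⋆ₙₐ[ℂ] (H →L[ℂ] H)) (m : CStarMatrix F F A)
    (ξ : lp (fun _ : G => H) 2) (k : F) :
    matrixOp F ρ m ξ k = ∑ l : F, ρ (m k l) (ξ l) := by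
  classical
  simp only [matrixOp, sum_apply, lp.coeFn_sum, Finset.sum_apply, entryOp_apply]
  rw [Finset.sum_eq_single k]
  · simp
  · intro k' _ hk'
    have : ¬ (k : G) = k' := fun h => hk' (Subtype.ext h.symm)
    simp [this]
  · simp

theorem matrixOp_apply_notMem (ρ : A →⋆ₙₐ[ℂ] (H →L[ℂ] H)) (m : CStarMatrix F F A)
    (ξ : lp (fun _ : G => H) 2) (k : G) (hk : k ∉ F) : matrixOp F ρ m ξ k = 0 := by
  classical
  simp only [matrixOp, sum_apply, lp.coeFn_sum, Finset.sum_apply, entryOp_apply]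
  refine Finset.sum_eq_zero fun k' _ => Finset.sum_eq_zero fun l _ => if_neg ?_
  rintro rfl
  exact hk k'.2

theorem lp_op_ext {S T : lp (fun _ : G => H) 2 →L[ℂ] lp (fun _ : G => H) 2}
    (h : ∀ ξ g, S ξ g = T ξ g) : S = T :=
  ContinuousLinearMap.ext fun ξ => lp.ext (funext (h ξ))

/-- This reduces the adjoint computation in `matrixRep` to finite sums, where it becomes an exchange
of the two summations together with the adjoint rule for each entry. -/
theorem inner_matrixOp (ρ : A →⋆ₙₐ[ℂ] (H →L[ℂ] H)) (m : CStarMatrix F F A)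
    (ξ η : lp (fun _ : G => H) 2) :
    inner ℂ η (matrixOp F ρ m ξ) = ∑ k : F, ∑ l : F, inner ℂ (η k) (ρ (m k l) (ξ l)) := by
  rw [lp.inner_eq_tsum, tsum_eq_sum (s := F), ← Finset.sum_coe_sort]
  · refine Finset.sum_congr rfl fun k _ => ?_
    rw [matrixOp_apply_mem, inner_sum]
  · intro k hk
    rw [matrixOp_apply_notMem F ρ m ξ k hk, inner_zero_right]

/-- The representation of `M_F(A)` on `ℓ²(G, H)` induced by a representation of `A` on `H`. -/
noncomputable def matrixRep (ρ : A →⋆ₙₐ[ℂ] (H →L[ℂ] H)) :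
    CStarMatrix F F A →⋆ₙₐ[ℂ] (lp (fun _ : G => H) 2 →L[ℂ] lp (fun _ : G => H) 2) where
  toFun := matrixOp F ρ
  map_smul' c m := lp_op_ext fun ξ g => by
    by_cases hg : g ∈ F
    · have h1 := matrixOp_apply_mem F ρ (c • m) ξ ⟨g, hg⟩
      have h2 := matrixOp_apply_mem F ρ m ξ ⟨g, hg⟩
      simp only [MonoidHom.id_apply, smul_apply, lp.coeFn_smul, Pi.smul_apply] at h1 h2 ⊢
      rw [h1, h2, Finset.smul_sum]
      exact Finset.sum_congr rfl fun l _ => by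
        rw [CStarMatrix.smul_apply, map_smul, smul_apply]
    · simp only [MonoidHom.id_apply, smul_apply, lp.coeFn_smul, Pi.smul_apply,
        matrixOp_apply_notMem F ρ _ ξ g hg, smul_zero]
  map_zero' := by simp [matrixOp, entryOp]
  map_add' m n := lp_op_ext fun ξ g => by
    by_cases hg : g ∈ F
    · have h1 := matrixOp_apply_mem F ρ (m + n) ξ ⟨g, hg⟩
      have h2 := matrixOp_apply_mem F ρ m ξ ⟨g, hg⟩
      have h3 := matrixOp_apply_mem F ρ n ξ ⟨g, hg⟩
      simp only [add_apply, lp.coeFn_add, Pi.add_apply] at h1 h2 h3 ⊢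
      rw [h1, h2, h3, ← Finset.sum_add_distrib]
      exact Finset.sum_congr rfl fun l _ => by
        rw [CStarMatrix.add_apply, map_add, add_apply]
    · simp only [add_apply, lp.coeFn_add, Pi.add_apply,
        matrixOp_apply_notMem F ρ _ ξ g hg, add_zero]
  map_mul' m n := lp_op_ext fun ξ g => by
    rw [mul_apply_eq_comp]
    by_cases hg : g ∈ F
    · have h1 := matrixOp_apply_mem F ρ (m * n) ξ ⟨g, hg⟩
      have h2 := matrixOp_apply_mem F ρ m (matrixOp F ρ n ξ) ⟨g, hg⟩
      simp only at h1 h2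
      rw [h1, h2]
      simp only [matrixOp_apply_mem, CStarMatrix.mul_apply, map_sum, map_mul,
        sum_apply, mul_apply_eq_comp]
      exact Finset.sum_comm
    · rw [matrixOp_apply_notMem F ρ _ ξ g hg, matrixOp_apply_notMem F ρ _ _ g hg]
  map_star' m := by
    rw [ContinuousLinearMap.star_eq_adjoint, ContinuousLinearMap.eq_adjoint_iff]
    intro ξ η
    rw [← inner_conj_symm, inner_matrixOp, inner_matrixOp, map_sum, Finset.sum_comm]
    simp only [map_sum]
    refine Finset.sum_congr rfl fun k _ => Finset.sum_congr rfl fun l _ => ?_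
    rw [inner_conj_symm, CStarMatrix.star_apply, map_star, ContinuousLinearMap.star_eq_adjoint,
      ContinuousLinearMap.adjoint_inner_left]

-- Applying the operator to a vector `v` placed at `l` and reading coordinate `k` recovers `ρ i (m k
-- l) v`, so joint faithfulness passes from `A` to `M_F(A)` entry by entry.
open Classical in
theorem matrixRep_eq_zero {ι : Type*} {K : ι → Type w} [∀ i, NormedAddCommGroup (K i)]
    [∀ i, InnerProductSpace ℂ (K i)] [∀ i, CompleteSpace (K i)]
    (ρ : ∀ i, A →⋆ₙₐ[ℂ] (K i →L[ℂ] K i)) (hρ : ∀ a, (∀ i, ρ i a = 0) → a = 0)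
    (m : CStarMatrix F F A) (hm : ∀ i, matrixRep F (ρ i) m = 0) : m = 0 := by
  ext k l
  refine hρ _ fun i => ContinuousLinearMap.ext fun v => ?_
  have h1 := matrixOp_apply_mem F (ρ i) m (lp.single 2 (l : G) v) k
  have h2 : matrixOp F (ρ i) m = 0 := hm i
  rw [h2, Finset.sum_eq_single l] at h1
  · simpa using h1.symm
  · intro l' _ hl'
    rw [lp.single_apply_ne _ _ _ fun h => hl' (Subtype.ext h), map_zero]
  · simp

variable (H) in
open Classical in
theorem sum_truncation_le (ξ : lp (fun _ : G => H) 2) (F' : Finset G) :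
    ∑ g ∈ F', ‖if g ∈ F then ξ g else 0‖ ^ 2 ≤ ‖ξ‖ ^ 2 := by
  have h1 : ∑ g ∈ F', ‖ξ g‖ ^ 2 ≤ ‖ξ‖ ^ 2 := by
    simpa using lp.sum_rpow_le_norm_rpow (p := 2) (by norm_num) ξ F'
  refine (Finset.sum_le_sum fun g _ => ?_).trans h1
  split_ifs
  · rfl
  · simp

open Classical in
/-- The orthogonal truncation of `ξ ∈ ℓ²(G, H)` to `F`. -/
noncomputable def truncation (ξ : lp (fun _ : G => H) 2) : lp (fun _ : G => H) 2 :=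
  ⟨fun g => if g ∈ F then ξ g else 0,
    memℓp_gen' (C := ‖ξ‖ ^ 2) fun F' => by simpa using sum_truncation_le H F ξ F'⟩

open Classical in
theorem truncation_apply (ξ : lp (fun _ : G => H) 2) (g : G) :
    truncation F ξ g = if g ∈ F then ξ g else 0 := rfl

theorem norm_truncation_le (ξ : lp (fun _ : G => H) 2) : ‖truncation F ξ‖ ≤ ‖ξ‖ := by
  classical
  apply lp.norm_le_of_forall_sum_le (p := 2) (by norm_num) (norm_nonneg _)
  intro F'
  simpa [truncation_apply] using sum_truncation_le H F ξ F'

end Truncation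

/-! ### The crossed product norm through finite compressions, and its independence of the faithful
representation. -/

section CrossedNorm

variable {G : Type v} [Group G] {A : Type u} [NonUnitalCStarAlgebra A] (α : G →* (A ≃⋆ₐ[ℂ] A))
  (F : Finset G)

variable {α} in
/-- The coefficient `x_g` of `x = ∑ x_g δ_g`. -/
def CrossedAlg.coeff (x : CrossedAlg α) (g : G) : A := (show G →₀ A from x) g

variable {α} in
/-- The support of `x = ∑ x_g δ_g`. -/
def CrossedAlg.support (x : CrossedAlg α) : Finset G := Finsupp.support (show G →₀ A from x)

variable {α} in
theorem CrossedAlg.coeff_eq_zero (x : CrossedAlg α) {g : G} (hg : g ∉ x.support) : x.coeff g = 0 :=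
  Finsupp.notMem_support_iff.1 hg

/-- The compression of `x ∈ AG` to `F`, a matrix with entries `α_k⁻¹(x_{k l⁻¹})`. -/
def compression (x : CrossedAlg α) : CStarMatrix F F A :=
  CStarMatrix.ofMatrix fun k l : F => α (k : G)⁻¹ (x.coeff ((k : G) * (l : G)⁻¹))

variable {H : Type w} [NormedAddCommGroup H] [InnerProductSpace ℂ H] [CompleteSpace H]
  (ρ : A →⋆ₙₐ[ℂ] (H →L[ℂ] H))

theorem crossedRep_apply (x : CrossedAlg α) (ξ : lp (fun _ : G => H) 2) (k : G) :
    crossedRep α ρ x ξ k =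
      ∑ g ∈ x.support, ρ (α k⁻¹ (x.coeff g)) (ξ (g⁻¹ * k)) := by
  change (∑ g ∈ x.support, inducedRep α ρ (x.coeff g) * leftTranslation H g) ξ k = _
  simp only [sum_apply, lp.coeFn_sum, Finset.sum_apply]
  rfl

/-- The substitution `l = g⁻¹k`, that is `g = kl⁻¹`, turns the operator into a matrix with entries
those of `compression`. The condition on `F` holds in two situations: when `ξ` vanishes off `F`, and
when `F` contains every `g⁻¹k` with `g` in the support of `x`. -/
theorem crossedRep_apply_eq_sum [DecidableEq G] (x : CrossedAlg α) (ξ : lp (fun _ : G => H) 2)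
    (k : G) (hF : ∀ g ∈ x.support, ξ (g⁻¹ * k) ≠ 0 → g⁻¹ * k ∈ F) :
    crossedRep α ρ x ξ k = ∑ l ∈ F, ρ (α k⁻¹ (x.coeff (k * l⁻¹))) (ξ l) := by
  rw [crossedRep_apply]
  have h1 : ∑ l ∈ F, ρ (α k⁻¹ (x.coeff (k * l⁻¹))) (ξ l) =
      ∑ g ∈ F.image fun l => k * l⁻¹, ρ (α k⁻¹ (x.coeff g)) (ξ (g⁻¹ * k)) := by
    rw [Finset.sum_image fun a _ b _ h => by simpa using h]
    exact Finset.sum_congr rfl fun l _ => by simp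
  rw [h1]
  -- The index sets `x.support` and `{kl⁻¹ : l ∈ F}` differ only where the summand is zero: on the
  -- first alone the vector vanishes, on the second alone the coefficient does.
  refine Finset.sum_congr_of_eq_on_inter ?_ ?_ fun _ _ _ => rfl
  · intro g hg hg'
    by_contra hne
    refine hg' (Finset.mem_image.2 ⟨g⁻¹ * k, hF g hg fun h0 => hne (by rw [h0, map_zero]), ?_⟩)
    simp
  · intro g _ hg
    rw [x.coeff_eq_zero hg, map_zero, map_zero, zero_apply]

/-- With `P` the projection onto functions supported in `F`, the matrix acts as `P T P` for the
induced operator `T`. Since `P` is a contraction, compressions cannot increase the norm. -/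
theorem matrixRep_compression_apply (x : CrossedAlg α) (ξ : lp (fun _ : G => H) 2) :
    matrixRep F ρ (compression α F x) ξ = truncation F (crossedRep α ρ x (truncation F ξ)) := by
  classical
  ext k
  rw [truncation_apply]
  split_ifs with hk
  · rw [crossedRep_apply_eq_sum α F ρ x _ k, ← Finset.sum_coe_sort]
    · refine (matrixOp_apply_mem F ρ _ ξ ⟨k, hk⟩).trans (Finset.sum_congr rfl fun l _ => ?_)
      rw [truncation_apply, if_pos l.2]
      rfl
    · intro g _ h
      by_contra h'
      exact h (by rw [truncation_apply, if_neg h'])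
  · exact matrixOp_apply_notMem F ρ _ ξ k hk

theorem norm_matrixRep_compression_le (x : CrossedAlg α) :
    ‖matrixRep F ρ (compression α F x)‖ ≤ ‖crossedRep α ρ x‖ := by
  refine ContinuousLinearMap.opNorm_le_bound _ (norm_nonneg _) fun ξ => ?_
  rw [matrixRep_compression_apply]
  refine (norm_truncation_le F _).trans ((ContinuousLinearMap.le_opNorm _ _).trans ?_)
  gcongr
  exact norm_truncation_le F ξ

/-- As `x` has finite support, each coordinate of the image of `ξ` involves finitely many
coordinates of `ξ`. Any finite set of output coordinates is therefore computed exactly by a large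
enough compression. -/
theorem norm_crossedRep_le_of_matrixRep (x : CrossedAlg α) {C : ℝ} (hC : 0 ≤ C)
    (h : ∀ F : Finset G, ‖matrixRep F ρ (compression α F x)‖ ≤ C) : ‖crossedRep α ρ x‖ ≤ C := by
  classical
  refine ContinuousLinearMap.opNorm_le_bound _ hC fun ξ => ?_
  apply lp.norm_le_of_forall_sum_le (p := 2) (by norm_num) (by positivity)
  intro F'
  -- The output coordinates `F'` together with all input coordinates on which they depend.
  let F : Finset G := F' ∪ F'.biUnion fun k => x.support.image fun g => g⁻¹ * k
  have h1 : ∀ k ∈ F', crossedRep α ρ x ξ k = matrixRep F ρ (compression α F x) ξ k := by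
    intro k hk
    rw [crossedRep_apply_eq_sum α F ρ x ξ k, ← Finset.sum_coe_sort]
    · exact (matrixOp_apply_mem F ρ (compression α F x) ξ
        ⟨k, Finset.mem_union_left _ hk⟩).symm
    · intro g hg _
      exact Finset.mem_union_right _
        (Finset.mem_biUnion.2 ⟨k, hk, Finset.mem_image_of_mem _ hg⟩)
  have h2 := lp.sum_rpow_le_norm_rpow (p := 2) (by norm_num)
    (matrixRep F ρ (compression α F x) ξ) F'
  have h3 : ‖matrixRep F ρ (compression α F x) ξ‖ ≤ C * ‖ξ‖ :=
    (ContinuousLinearMap.le_opNorm _ _).trans (by gcongr; exact h F)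
  rw [Finset.sum_congr rfl fun k hk => by rw [h1 k hk]]
  refine h2.trans ?_
  gcongr

/-- The matrices `compression α F x` do not involve a representation: `ρ` is contractive on
`M_F(A)`, while the family `σ` determines the norm there. The lemma serves in both directions of the
norm comparison, once with `σ` a single faithful representation and once with `σ` the family of the
`λₓ`. -/
theorem norm_crossedRep_le_of_jointly_faithful {ι : Type*} {K : ι → Type*}
    [∀ i, NormedAddCommGroup (K i)] [∀ i, InnerProductSpace ℂ (K i)] [∀ i, CompleteSpace (K i)]
    (σ : ∀ i, A →⋆ₙₐ[ℂ] (K i →L[ℂ] K i)) (hσ : ∀ a, (∀ i, σ i a = 0) → a = 0)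
    (x : CrossedAlg α) {C : ℝ} (hC : 0 ≤ C) (h : ∀ i, ‖crossedRep α (σ i) x‖ ≤ C) :
    ‖crossedRep α ρ x‖ ≤ C := by
  -- The C*-norm on `CStarMatrix F F A` requires an order on `A`; the spectral order supplies it.
  let _ : PartialOrder A := CStarAlgebra.spectralOrder A
  have _ : StarOrderedRing A := CStarAlgebra.spectralOrderedRing A
  refine norm_crossedRep_le_of_matrixRep α ρ x hC fun F => ?_
  refine (NonUnitalStarAlgHom.norm_apply_le (matrixRep F ρ) _).trans ?_
  exact norm_le_of_jointly_injective (fun i => matrixRep F (σ i)) (matrixRep_eq_zero F σ hσ) hC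
    fun i => (norm_matrixRep_compression_le α F (σ i) x).trans (h i)

end CrossedNorm

/-! ### Unitary equivalence by comparing matrix coefficients. -/

section Bases

variable {I : Type*} {J : Type*}

/-- Bounded operators are determined by their matrix coefficients. All unitary equivalences below
are obtained this way, with a basis of the source space indexed by the target fibre. -/
theorem conj_hilbertBasis_eq {I : Type u} [DecidableEq I] {K : Type*} [NormedAddCommGroup K]
    [InnerProductSpace ℂ K] [CompleteSpace K] (b : HilbertBasis I ℂ K) (S : K →L[ℂ] K)
    (T : lp (fun _ : I => ℂ) 2 →L[ℂ] lp (fun _ : I => ℂ) 2)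
    (h : ∀ i j, inner ℂ (b i) (S (b j)) = T (lp.single 2 j 1) i) :
    b.repr.conjStarAlgEquiv S = T := by
  refine ext_single fun i j => ?_
  rw [LinearIsometryEquiv.conjStarAlgEquiv_apply_apply, b.repr_symm_single, b.repr_apply_apply, h]

/-- Conjugation by a unitary, as a homomorphism of non-unital *-algebras. -/
noncomputable def conjHom {K L : Type*} [NormedAddCommGroup K] [InnerProductSpace ℂ K]
    [CompleteSpace K] [NormedAddCommGroup L] [InnerProductSpace ℂ L] [CompleteSpace L]
    (e : K ≃ₗᵢ[ℂ] L) : (K →L[ℂ] K) →⋆ₙₐ[ℂ] (L →L[ℂ] L) where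
  toFun := e.conjStarAlgEquiv
  map_smul' := map_smul e.conjStarAlgEquiv
  map_zero' := map_zero e.conjStarAlgEquiv
  map_add' := map_add e.conjStarAlgEquiv
  map_mul' := map_mul e.conjStarAlgEquiv
  map_star' := map_star e.conjStarAlgEquiv

theorem norm_conjStarAlgEquiv {K L : Type*} [NormedAddCommGroup K] [InnerProductSpace ℂ K]
    [CompleteSpace K] [NormedAddCommGroup L] [InnerProductSpace ℂ L] [CompleteSpace L]
    (e : K ≃ₗᵢ[ℂ] L) (S : K →L[ℂ] K) : ‖e.conjStarAlgEquiv S‖ = ‖S‖ :=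
  NonUnitalStarAlgHom.norm_map e.conjStarAlgEquiv e.conjStarAlgEquiv.injective S

open Classical in
/-- The standard basis of `ℓ²(J)`, indexed through a bijection. -/
noncomputable def lpBasis (e : I ≃ J) : HilbertBasis I ℂ (lp (fun _ : J => ℂ) 2) :=
  HilbertBasis.mkOfOrthogonalEqBot (v := fun i => lp.single 2 (e i) 1)
    (orthonormal_iff_ite.2 fun i j => by
      rw [lp.inner_single_left, lp.single_apply, Pi.single_apply]
      simp only [e.injective.eq_iff]
      split_ifs <;> simp)
    ((Submodule.eq_bot_iff _).2 fun ξ hξ => by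
      ext j
      have h1 := (Submodule.mem_orthogonal _ _).1 hξ _ (Submodule.subset_span ⟨e.symm j, rfl⟩)
      simpa [lp.inner_single_left] using h1)

theorem lpBasis_apply [DecidableEq J] (e : I ≃ J) (i : I) : lpBasis e i = lp.single 2 (e i) 1 := by
  rw [lpBasis, HilbertBasis.coe_mkOfOrthogonalEqBot]
  congr!

open Classical in
/-- The standard basis of `ℓ²(G, ℓ²(J))`, indexed through a bijection. -/
noncomputable def lpLpBasis {G : Type*} (e : I ≃ G × J) :
    HilbertBasis I ℂ (lp (fun _ : G => lp (fun _ : J => ℂ) 2) 2) :=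
  HilbertBasis.mkOfOrthogonalEqBot (v := fun i => lp.single 2 (e i).1 (lp.single 2 (e i).2 1))
    (orthonormal_iff_ite.2 fun i j => by
      have h : i = j ↔ (e i).1 = (e j).1 ∧ (e i).2 = (e j).2 := by
        rw [← Prod.ext_iff, e.injective.eq_iff]
      rw [lp.inner_single_left, lp.single_apply, Pi.single_apply]
      by_cases h1 : (e i).1 = (e j).1
      · rw [if_pos h1, lp.inner_single_left, lp.single_apply, Pi.single_apply]
        simp only [h, h1, true_and]
        split_ifs <;> simp
      · simp [h, h1])
    ((Submodule.eq_bot_iff _).2 fun ξ hξ => by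
      ext g j
      have h1 := (Submodule.mem_orthogonal _ _).1 hξ _
        (Submodule.subset_span ⟨e.symm (g, j), rfl⟩)
      simpa [lp.inner_single_left] using h1)

theorem lpLpBasis_apply {G : Type*} [DecidableEq G] [DecidableEq J] (e : I ≃ G × J) (i : I) :
    lpLpBasis e i = lp.single 2 (e i).1 (lp.single 2 (e i).2 1) := by
  rw [lpLpBasis, HilbertBasis.coe_mkOfOrthogonalEqBot]
  congr!

end Bases

/-! ### The action on `C*_r(𝒢)` induced by automorphisms of `𝒢`. -/

section Automorphism

variable {𝒢 : Type u} [TopologicalSpace 𝒢] [Gpd 𝒢]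

/-- The bijection of source fibres induced by an automorphism. -/
def GpdAut.fiberEquiv (φ : GpdAut 𝒢) (x y : units 𝒢) (h : φ x = y) :
    sourceFiber x ≃ sourceFiber y :=
  φ.toHomeomorph.toEquiv.subtypeEquiv fun γ => by
    change s γ = x ↔ s (φ γ) = y
    rw [← φ.map_s, ← h]
    exact φ.toHomeomorph.injective.eq_iff.symm

theorem GpdAut.apply_divFiber (φ : GpdAut 𝒢) (x y : units 𝒢) (h : φ x = y)
    (γ η : sourceFiber x) :
    φ (divFiber γ η) = divFiber (φ.fiberEquiv x y h γ) (φ.fiberEquiv x y h η) :=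
  (φ.map_comp _ _ _).trans (comp_congr _ rfl (φ.map_inv _))

variable [IsEtale 𝒢]

/-- The *-automorphism `f ↦ f ∘ φ` of `C_c(𝒢)`. -/
noncomputable def Cc.compAut (φ : GpdAut 𝒢) : Cc 𝒢 →⋆ₙₐ[ℂ] Cc 𝒢 where
  toFun f := Cc.mk (fun γ => f (φ γ)) (f.continuous.comp φ.continuous)
    (f.hasCompactSupport.comp_homeomorph φ.toHomeomorph)
  map_smul' _ _ := rfl
  map_zero' := rfl
  map_add' _ _ := rfl
  map_mul' f g := by
    ext γ
    rw [Cc.mk_apply, Cc.mul_apply, Cc.mul_apply]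
    -- `φ` carries the index set of the convolution sum at `γ` onto that of the sum at `φ γ`.
    let E : {η : 𝒢 // r η = s γ} ≃ {η : 𝒢 // r η = s (φ γ)} :=
      φ.toHomeomorph.toEquiv.subtypeEquiv fun η => by
        change r η = s γ ↔ r (φ η) = s (φ γ)
        rw [← φ.map_s, ← φ.map_r]
        exact φ.toHomeomorph.injective.eq_iff.symm
    rw [← E.tsum_eq]
    refine tsum_congr fun η => ?_
    rw [Cc.mk_apply, Cc.mk_apply, φ.map_comp, φ.map_inv]
    rfl
  map_star' f := by
    ext γ
    rw [Cc.mk_apply, Cc.star_apply, Cc.star_apply, Cc.mk_apply, φ.map_inv]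

theorem Cc.compAut_apply (φ : GpdAut 𝒢) (f : Cc 𝒢) (γ : 𝒢) : Cc.compAut φ f γ = f (φ γ) := rfl

/-- Precomposition reverses products, which is why the action of `g` must use `(α g)⁻¹`. -/
theorem Cc.compAut_compAut (φ ψ : GpdAut 𝒢) (f : Cc 𝒢) :
    Cc.compAut φ (Cc.compAut ψ f) = Cc.compAut (ψ * φ) f := rfl

theorem Cc.compAut_one (f : Cc 𝒢) : Cc.compAut 1 f = f := rfl

/-- The bijection of fibres induced by `φ` gives a unitary from `ℓ²(𝒢_y)` to `ℓ²(𝒢ₓ)`. It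
intertwines the two operators because `φ` respects the quotients `γη⁻¹` that index their matrix
entries. -/
theorem norm_regularRep_compAut (φ : GpdAut 𝒢) (f : Cc 𝒢) (x y : units 𝒢) (h : φ x = y) :
    ‖regularRep x (Cc.compAut φ f)‖ = ‖regularRep y f‖ := by
  classical
  rw [← conj_hilbertBasis_eq (lpBasis (φ.fiberEquiv x y h)) (regularRep y f)
    (regularRep x (Cc.compAut φ f)), norm_conjStarAlgEquiv]
  intro γ η
  rw [lpBasis_apply, lpBasis_apply, lp.inner_single_left]
  have h1 := regularRep_single y f (φ.fiberEquiv x y h γ) (φ.fiberEquiv x y h η)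
  have h2 := regularRep_single x (Cc.compAut φ f) γ η
  rw [Cc.compAut_apply, φ.apply_divFiber x y h] at h2
  rw [h2, ← h1]
  simp

theorem norm_toReduced_compAut_le (φ : GpdAut 𝒢) (f : Cc 𝒢) :
    ‖toReduced (Cc.compAut φ f)‖ ≤ ‖toReduced f‖ := by
  refine lp.norm_le_of_forall_le (norm_nonneg _) fun x => ?_
  have hy : r (φ x) = φ x := by rw [← φ.map_r, x.2]
  exact (norm_regularRep_compAut φ f x ⟨φ x, hy⟩ rfl).trans_le
    (le_ciSup (bddAbove_norm_regularRep f) _)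

theorem norm_toReduced_compAut (φ : GpdAut 𝒢) (f : Cc 𝒢) :
    ‖toReduced (Cc.compAut φ f)‖ = ‖toReduced f‖ := by
  refine (norm_toReduced_compAut_le φ f).antisymm ?_
  -- The reverse inequality is the same bound for `φ⁻¹`, applied to `f ∘ φ`.
  have h := norm_toReduced_compAut_le φ⁻¹ (Cc.compAut φ f)
  rwa [Cc.compAut_compAut, mul_inv_cancel, Cc.compAut_one] at h

theorem continuous_nonUnitalStarAlgHom {A B : Type*} [NonUnitalCStarAlgebra A]
    [NonUnitalCStarAlgebra B] (φ : A →⋆ₙₐ[ℂ] B) : Continuous φ :=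
  AddMonoidHomClass.continuous_of_bound φ 1 fun a => by
    rw [one_mul]
    exact NonUnitalStarAlgHom.norm_apply_le φ a

theorem reducedCStar_hom_ext {B : Type*} [NonUnitalCStarAlgebra B]
    {φ ψ : ReducedCStar 𝒢 →⋆ₙₐ[ℂ] B}
    (h : ∀ f, φ (toReduced f) = ψ (toReduced f)) (a : ReducedCStar 𝒢) : φ a = ψ a := by
  have hφ : Continuous φ := continuous_nonUnitalStarAlgHom φ
  have hψ : Continuous ψ := continuous_nonUnitalStarAlgHom ψ
  exact congrFun (denseRange_toReduced.equalizer hφ hψ (funext h)) a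

theorem exists_reducedAction {G : Type v} [Group G] (α : G →* GpdAut 𝒢) :
    ∃ β : G →* (ReducedCStar 𝒢 ≃⋆ₐ[ℂ] ReducedCStar 𝒢),
      ∀ g f, β g (toReduced f) = toReduced (Cc.compAut (α g)⁻¹ f) := by
  have h : ∀ g, ∃ Φ : ReducedCStar 𝒢 ≃⋆ₐ[ℂ] ReducedCStar 𝒢,
      ∀ f, Φ (toReduced f) = toReduced (Cc.compAut (α g)⁻¹ f) := fun g => by
    refine exists_starAlgEquiv_of_norm_eq toReduced (toReduced.comp (Cc.compAut (α g)⁻¹))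
      denseRange_toReduced ?_ fun f => (norm_toReduced_compAut _ f).symm
    refine denseRange_toReduced.mono ?_
    rintro _ ⟨f, rfl⟩
    -- Composition with `α g` undoes composition with `(α g)⁻¹`, so the second map still has all of
    -- `C_c(𝒢)` in its image.
    refine ⟨Cc.compAut (α g) f, ?_⟩
    change toReduced (Cc.compAut (α g)⁻¹ (Cc.compAut (α g) f)) = _
    rw [Cc.compAut_compAut, mul_inv_cancel, Cc.compAut_one]
  choose β hβ using h
  -- Multiplicativity is checked on the dense subalgebra `C_c(𝒢)`, where the order reversal of
  -- precomposition cancels that of inversion.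
  refine ⟨MonoidHom.mk' β fun g k => StarAlgEquiv.ext fun a => ?_, hβ⟩
  refine reducedCStar_hom_ext (φ := (β (g * k) : ReducedCStar 𝒢 →⋆ₙₐ[ℂ] ReducedCStar 𝒢))
    (ψ := (β g : ReducedCStar 𝒢 →⋆ₙₐ[ℂ] ReducedCStar 𝒢).comp
      (β k : ReducedCStar 𝒢 →⋆ₙₐ[ℂ] ReducedCStar 𝒢)) (fun f => ?_) a
  change β (g * k) (toReduced f) = β g (β k (toReduced f))
  rw [hβ, hβ, hβ, Cc.compAut_compAut, map_mul, mul_inv_rev]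

end Automorphism

/-! ### Matrix coefficients of the representation of `AG`. -/

section MatrixCoefficients

variable {A : Type u} [NonUnitalCStarAlgebra A] {G : Type v} [Group G] [DecidableEq G]
  {H : Type w} [NormedAddCommGroup H] [InnerProductSpace ℂ H] [CompleteSpace H]

theorem inner_crossedRep_single (α : G →* (A ≃⋆ₐ[ℂ] A)) (ρ : A →⋆ₙₐ[ℂ] (H →L[ℂ] H))
    (a : A) (h g k : G) (v w : H) :
    inner ℂ (lp.single (E := fun _ : G => H) 2 g w)
        (crossedRep α ρ (CrossedAlg.single α h a) (lp.single (E := fun _ : G => H) 2 k v)) =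
      if h⁻¹ * g = k then inner ℂ w (ρ (α g⁻¹ a) v) else 0 := by
  rw [lp.inner_single_left]
  change inner ℂ w (crossedRepFun α ρ (CrossedAlg.single α h a) _ g) = _
  rw [crossedRepFun_single, mul_apply_eq_comp, inducedRep_apply, leftTranslation_apply,
    lp.single_apply, Pi.single_apply]
  split_ifs
  · rfl
  · rw [map_zero, inner_zero_right]

end MatrixCoefficients

/-! ### Source fibres of the semidirect product. -/

section CrossedIso

variable {𝒢 : Type u} [TopologicalSpace 𝒢] [Gpd 𝒢]

section
variable [IsEtale 𝒢]

/-- The representation `λₓ` of `C*_r(𝒢)` on `ℓ²(𝒢ₓ)`. -/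
noncomputable def reducedRep (x : units 𝒢) : ReducedCStar 𝒢 →⋆ₙₐ[ℂ]
    (lp (fun _ : sourceFiber x => ℂ) 2 →L[ℂ] lp (fun _ : sourceFiber x => ℂ) 2) where
  toFun a := a.1.1 x
  map_smul' _ _ := rfl
  map_zero' := rfl
  map_add' _ _ := rfl
  map_mul' _ _ := rfl
  map_star' _ := rfl

theorem reducedRep_toReduced (x : units 𝒢) (f : Cc 𝒢) :
    reducedRep x (toReduced f) = regularRep x f := rfl

theorem reducedRep_jointly_faithful (a : ReducedCStar 𝒢) (h : ∀ x, reducedRep x a = 0) : a = 0 :=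
  Subtype.ext (lp.ext (funext h))

end

variable {G : Type v} [Group G] {α : G →* GpdAut 𝒢}

/-- The unit `x` of `𝒢` underlying a unit `(x, e)` of `𝒢 ⋊ G`. -/
def Semidirect.baseUnit (y : units (Semidirect α)) : units 𝒢 :=
  ⟨y.1.1, congrArg Prod.fst (show r y.1 = y.1 from y.2)⟩

/-- Every `λₓ` thus occurs among the representations indexed by units of `𝒢 ⋊ G`, so that this
family is jointly faithful on `C*_r(𝒢)`. -/
theorem Semidirect.baseUnit_surjective :
    Function.Surjective (Semidirect.baseUnit : units (Semidirect α) → units 𝒢) := fun x =>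
  ⟨⟨Semidirect.mk α x.1 1, Prod.ext x.2 rfl⟩, rfl⟩

/-- The bijection `(γ, g) ↦ (g, γ · g)` of the source fibre of `𝒢 ⋊ G` over `(x, e)` with
`G × 𝒢ₓ`. -/
def Semidirect.fiberEquiv (y : units (Semidirect α)) :
    sourceFiber y ≃ G × sourceFiber (Semidirect.baseUnit y) where
  toFun p := (p.1.2, ⟨rightAct α p.1.1 p.1.2, by
    rw [← rightAct_s]; exact congrArg Prod.fst (show s p.1 = y.1 from p.2)⟩)
  invFun q := ⟨Semidirect.mk α (rightAct α q.2.1 q.1⁻¹) q.1, Prod.ext (by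
      change rightAct α (s (rightAct α q.2.1 q.1⁻¹)) q.1 = y.1.1
      rw [← rightAct_s, rightAct_cancel']
      exact q.2.2)
    (show (1 : G) = y.1.2 from congrArg Prod.snd (show r y.1 = y.1 from y.2))⟩
  left_inv p := Subtype.ext (Prod.ext (rightAct_cancel α _ _) rfl)
  right_inv q := Prod.ext rfl (Subtype.ext (rightAct_cancel' α _ _))

theorem Semidirect.divFiber_snd {y : units (Semidirect α)} (p q : sourceFiber y) :
    (divFiber p q).2 = p.1.2 * q.1.2⁻¹ := rfl

/-- For `p = (γ, g)` and `q = (η, k)`, the first coordinate of `pq⁻¹` is `γ(η⁻¹ · kg⁻¹) = ((γ · g)(η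
· k)⁻¹) · g⁻¹`, and acting by `g⁻¹` on the right is `α_g`. This twist is the one that `ρ̃`
introduces in coordinate `g`. -/
theorem Semidirect.divFiber_fst {y : units (Semidirect α)} (p q : sourceFiber y) :
    (divFiber p q).1 = α p.1.2
      (divFiber (Semidirect.fiberEquiv y p).2 (Semidirect.fiberEquiv y q).2) := by
  have h : ∀ γ, α p.1.2 γ = rightAct α γ p.1.2⁻¹ := fun γ => by rw [rightAct, inv_inv]
  rw [h]
  change comp p.1.1 (rightAct α (rightAct α (inv q.1.1) q.1.2) p.1.2⁻¹) _ =
    rightAct α (comp (rightAct α p.1.1 p.1.2) (inv (rightAct α q.1.1 q.1.2)) _) _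
  refine Eq.trans ?_ (rightAct_comp α _ _ _ _).symm
  exact comp_congr _ (rightAct_cancel α _ _).symm (by rw [rightAct_inv])

variable [TopologicalSpace G] [DiscreteTopology G]

/-! ### Decomposition of `C_c(𝒢 ⋊ G)` into slices `𝒢 × {h}`. -/

section Slices

open Classical in
/-- The element `f δ_h` of `C_c(𝒢 ⋊ G)`: the function `f` on `𝒢 × {h}`, extended by zero. -/
noncomputable def Cc.slice (α : G →* GpdAut 𝒢) (h : G) (f : Cc 𝒢) : Cc (Semidirect α) :=
  Cc.mk (fun p => if p.2 = h then f p.1 else 0)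
    (by
      change Continuous fun p : 𝒢 × G => if p.2 = h then f p.1 else 0
      rw [continuous_prod_of_discrete_right]
      intro g
      by_cases hg : g = h
      · simpa [hg] using f.continuous
      · simpa [hg] using continuous_const)
    (by
      have hK : IsCompact (tsupport f ×ˢ ({h} : Set G)) :=
        f.hasCompactSupport.isCompact.prod isCompact_singleton
      have hcl : IsClosed (tsupport f ×ˢ ({h} : Set G)) :=
        (isClosed_tsupport f).prod (isClosed_discrete _)
      change IsCompact (closure _)
      refine hK.of_isClosed_subset isClosed_closure (closure_minimal ?_ hcl)
      intro p hp
      have hp' : (if p.2 = h then f p.1 else 0) ≠ 0 := hp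
      have h1 : p.2 = h := by
        by_contra h1
        exact hp' (if_neg h1)
      rw [if_pos h1] at hp'
      exact ⟨subset_tsupport _ hp', h1⟩)

open Classical in
theorem Cc.slice_apply (h : G) (f : Cc 𝒢) (p : Semidirect α) :
    Cc.slice α h f p = if p.2 = h then f p.1 else 0 := rfl

/-- A compact support projects to a compact subset of the discrete group `G`, hence meets only
finitely many slices. -/
theorem Cc.exists_eq_sum_slice (F : Cc (Semidirect α)) :
    ∃ (S : Finset G) (f : G → Cc 𝒢), F = ∑ h ∈ S, Cc.slice α h (f h) := by
  classical
  have hK : IsCompact (tsupport F) := F.hasCompactSupport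
  have hfin : (Prod.snd '' (tsupport F : Set (𝒢 × G))).Finite :=
    isCompact_iff_finite.1 (hK.image (Semidirect.continuous_snd' (α := α)))
  let f : G → Cc 𝒢 := fun h => Cc.mk (fun γ => F (Semidirect.mk α γ h))
    (F.continuous.comp (Continuous.prodMk_left h : Continuous fun γ : 𝒢 => (γ, h)))
    (by
      -- Slices are closed, so restriction to a slice preserves compact support.
      have hemb : Topology.IsClosedEmbedding fun γ : 𝒢 => ((γ, h) : 𝒢 × G) := by
        refine ⟨Topology.IsEmbedding.of_leftInverse (f := Prod.fst) (fun _ => rfl) continuous_fst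
          (Continuous.prodMk_left h), ?_⟩
        have : Set.range (fun γ : 𝒢 => ((γ, h) : 𝒢 × G)) = Prod.snd ⁻¹' {h} := by
          ext ⟨a, b⟩
          simp [eq_comm]
        rw [this]
        exact (isClosed_discrete _).preimage continuous_snd
      exact F.hasCompactSupport.comp_isClosedEmbedding hemb)
  refine ⟨hfin.toFinset, f, Cc.ext fun p => ?_⟩
  have hsum : ∀ S : Finset G, (∑ h ∈ S, Cc.slice α h (f h)) p =
      ∑ h ∈ S, Cc.slice α h (f h) p := fun S => by
    induction S using Finset.induction_on with
    | empty => rfl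
    | insert a S ha ih => rw [Finset.sum_insert ha, Finset.sum_insert ha, Cc.add_apply, ih]
  rw [hsum]
  simp only [Cc.slice_apply, Finset.sum_ite_eq, Set.Finite.mem_toFinset]
  split_ifs with hp
  · rfl
  · by_contra h0
    exact hp ⟨p, subset_tsupport _ h0, rfl⟩

end Slices

/-! ### Comparison of the two norms and the isomorphism. -/

variable [IsEtale 𝒢] [Countable G] (β : G →* (ReducedCStar 𝒢 ≃⋆ₐ[ℂ] ReducedCStar 𝒢))

variable (α) in
/-- The representation of `AG`, `A = C*_r(𝒢)`, on `ℓ²` of a source fibre of `𝒢 ⋊ G` that is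
induced by `λₓ`. -/
noncomputable def fiberRep (y : units (Semidirect α)) : CrossedAlg β →⋆ₙₐ[ℂ]
    (lp (fun _ : sourceFiber y => ℂ) 2 →L[ℂ] lp (fun _ : sourceFiber y => ℂ) 2) :=
  (conjHom (lpLpBasis (Semidirect.fiberEquiv y)).repr).comp
    (crossedRep β (reducedRep (Semidirect.baseUnit y)))

theorem norm_fiberRep (y : units (Semidirect α)) (x : CrossedAlg β) :
    ‖fiberRep α β y x‖ = ‖crossedRep β (reducedRep (Semidirect.baseUnit y)) x‖ :=
  norm_conjStarAlgEquiv (lpLpBasis (Semidirect.fiberEquiv y)).repr _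

/-- Both operators have the same matrix. At `((γ, g), (η, k))` the entry is zero unless `gk⁻¹ = h`;
otherwise the crossed product gives the entry of `λₓ(f ∘ α_g)` at `(γ · g, η · k)`, which is `f` at
the first coordinate of `(γ, g)(η, k)⁻¹` by `Semidirect.divFiber_fst`. -/
theorem fiberRep_single (hβ : ∀ g f, β g (toReduced f) = toReduced (Cc.compAut (α g)⁻¹ f))
    (y : units (Semidirect α)) (h : G) (f : Cc 𝒢) :
    fiberRep α β y (CrossedAlg.single β h (toReduced f)) = regularRep y (Cc.slice α h f) := by
  classical
  refine conj_hilbertBasis_eq (lpLpBasis (Semidirect.fiberEquiv y)) _ _ fun p q => ?_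
  have h1 := regularRep_single y (Cc.slice α h f) p q
  have hiff : h⁻¹ * (Semidirect.fiberEquiv y p).1 = (Semidirect.fiberEquiv y q).1 ↔
      p.1.2 * q.1.2⁻¹ = h := by
    change h⁻¹ * p.1.2 = q.1.2 ↔ _
    rw [inv_mul_eq_iff_eq_mul, mul_inv_eq_iff_eq_mul]
  rw [Cc.slice_apply, Semidirect.divFiber_snd, Semidirect.divFiber_fst] at h1
  rw [lpLpBasis_apply, lpLpBasis_apply]
  refine (inner_crossedRep_single _ _ _ _ _ _ _ _).trans (Eq.trans ?_ h1.symm)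
  simp only [hiff]
  refine if_congr Iff.rfl ?_ rfl
  rw [hβ, reducedRep_toReduced, lp.inner_single_left]
  have h2 := regularRep_single (Semidirect.baseUnit y)
    (Cc.compAut (α (Semidirect.fiberEquiv y p).1⁻¹)⁻¹ f)
    (Semidirect.fiberEquiv y p).2 (Semidirect.fiberEquiv y q).2
  -- Coordinate `g` of `ρ̃` applies `β g⁻¹`, which is composition with `(α g⁻¹)⁻¹ = α g`.
  rw [Cc.compAut_apply, map_inv, inv_inv] at h2
  rw [map_inv, inv_inv]
  have h3 : ∀ z : ℂ, inner ℂ (1 : ℂ) z = z := fun z => by simp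
  exact (h3 _).trans h2

theorem norm_fiberRep_le {H : Type w} [NormedAddCommGroup H] [InnerProductSpace ℂ H]
    [CompleteSpace H] (ρ : ReducedCStar 𝒢 →⋆ₙₐ[ℂ] (H →L[ℂ] H)) (hρ : Function.Injective ρ)
    (y : units (Semidirect α)) (x : CrossedAlg β) : ‖fiberRep α β y x‖ ≤ ‖crossedRep β ρ x‖ := by
  rw [norm_fiberRep]
  exact norm_crossedRep_le_of_jointly_faithful β _ (ι := Unit) (fun _ => ρ)
    (fun a ha => (injective_iff_map_eq_zero ρ).1 hρ a (ha ())) x (norm_nonneg _) fun _ => le_rfl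

variable (α) in
/-- The representation of `AG`, `A = C*_r(𝒢)`, in `∏_y B(ℓ²((𝒢 ⋊ G)_y))`. -/
noncomputable def fiberRepFamily : CrossedAlg β →⋆ₙₐ[ℂ] RegularTarget (Semidirect α) where
  -- A bound uniform in `y` is needed to land in the ℓ^∞-product; the faithful representation
  -- `sumRep` provides one.
  toFun x := ⟨fun y => fiberRep α β y x, memℓp_infty ⟨‖crossedRep β (sumRep 𝒢) x‖, by
    rintro _ ⟨y, rfl⟩
    exact norm_fiberRep_le β (sumRep 𝒢) (sumRep_injective 𝒢) y x⟩⟩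
  map_smul' c x := lp.ext (funext fun y => map_smul (fiberRep α β y) c x)
  map_zero' := lp.ext (funext fun y => map_zero (fiberRep α β y))
  map_add' x x' := lp.ext (funext fun y => map_add (fiberRep α β y) x x')
  map_mul' x x' := lp.ext (funext fun y => map_mul (fiberRep α β y) x x')
  map_star' x := lp.ext (funext fun y => map_star (fiberRep α β y) x)

/-- Each side dominates the other by `norm_crossedRep_le_of_jointly_faithful`: `ρ` alone is
faithful, and the `λₓ` are jointly faithful because the norm of `C*_r(𝒢)` is defined by them. -/
theorem norm_fiberRepFamily {H : Type w} [NormedAddCommGroup H] [InnerProductSpace ℂ H]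
    [CompleteSpace H] (ρ : ReducedCStar 𝒢 →⋆ₙₐ[ℂ] (H →L[ℂ] H)) (hρ : Function.Injective ρ)
    (x : CrossedAlg β) : ‖fiberRepFamily α β x‖ = ‖crossedRep β ρ x‖ := by
  refine (lp.norm_le_of_forall_le (norm_nonneg _) fun y =>
    norm_fiberRep_le β ρ hρ y x).antisymm ?_
  refine norm_crossedRep_le_of_jointly_faithful β ρ
    (fun y : units (Semidirect α) => reducedRep (Semidirect.baseUnit y))
    (fun a ha => reducedRep_jointly_faithful a
      (Semidirect.baseUnit_surjective.forall.2 ha)) x (norm_nonneg _) fun y => ?_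
  rw [← norm_fiberRep]
  exact lp.norm_apply_le_norm ENNReal.top_ne_zero (fiberRepFamily α β x : lp _ ∞) y

theorem fiberRepFamily_single
    (hβ : ∀ g f, β g (toReduced f) = toReduced (Cc.compAut (α g)⁻¹ f)) (h : G) (f : Cc 𝒢) :
    fiberRepFamily α β (CrossedAlg.single β h (toReduced f)) =
      regularRepFamily (Semidirect α) (Cc.slice α h f) :=
  lp.ext (funext fun y => fiberRep_single β hβ y h f)

theorem norm_crossedRep_single_le {H : Type w} [NormedAddCommGroup H] [InnerProductSpace ℂ H]
    [CompleteSpace H] (ρ : ReducedCStar 𝒢 →⋆ₙₐ[ℂ] (H →L[ℂ] H)) (h : G) (a : ReducedCStar 𝒢) :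
    ‖crossedRep β ρ (CrossedAlg.single β h a)‖ ≤ ‖a‖ := by
  change ‖crossedRepFun β ρ _‖ ≤ _
  rw [crossedRepFun_single]
  have h1 : ‖inducedRep β ρ a‖ ≤ ‖a‖ := LinearMap.mkContinuous_norm_le _ (norm_nonneg _) _
  have h2 : ‖leftTranslation H h‖ ≤ 1 := LinearMap.mkContinuous_norm_le _ zero_le_one _
  calc _ ≤ ‖inducedRep β ρ a‖ * ‖leftTranslation H h‖ := norm_mul_le _ _
    _ ≤ ‖a‖ * 1 := by gcongr
    _ = ‖a‖ := mul_one _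

/-- The coefficients in `AG` are arbitrary elements of the completion `C*_r(𝒢)`, and only those from
`C_c(𝒢)` go to functions on `𝒢 ⋊ G`. The others are reached by density, since `a ↦ a δ_h` is
contractive. -/
theorem fiberRepFamily_mem (hβ : ∀ g f, β g (toReduced f) = toReduced (Cc.compAut (α g)⁻¹ f))
    (x : CrossedAlg β) : fiberRepFamily α β x ∈
      (NonUnitalStarAlgHom.range (regularRepFamily (Semidirect α))).topologicalClosure := by
  induction x using CrossedAlg.induction with
  | h0 => rw [map_zero]; exact zero_mem _
  | hadd x x' h h' => rw [map_add]; exact add_mem h h'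
  | hs h a =>
    let L : ReducedCStar 𝒢 →+ RegularTarget (Semidirect α) :=
      { toFun := fun a => fiberRepFamily α β (CrossedAlg.single β h a)
        map_zero' := by rw [CrossedAlg.single_zero, map_zero]
        map_add' := fun a b => by rw [CrossedAlg.single_add, map_add] }
    have hL : Continuous L := AddMonoidHomClass.continuous_of_bound L 1 fun a => by
      rw [one_mul]
      exact (norm_fiberRepFamily β (sumRep 𝒢) (sumRep_injective 𝒢) _).trans_le
        (norm_crossedRep_single_le β _ h a)
    have hcl : IsClosed (L ⁻¹' (NonUnitalStarAlgHom.range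
        (regularRepFamily (Semidirect α))).topologicalClosure) :=
      (NonUnitalStarSubalgebra.isClosed_topologicalClosure _).preimage hL
    refine (hcl.closure_subset_iff.2 ?_) (denseRange_toReduced a)
    rintro _ ⟨f, rfl⟩
    refine NonUnitalStarSubalgebra.le_topologicalClosure _ ⟨Cc.slice α h f, ?_⟩
    exact (fiberRepFamily_single β hβ h f).symm

theorem exists_crossedProduct_equiv
    (hβ : ∀ g f, β g (toReduced f) = toReduced (Cc.compAut (α g)⁻¹ f))
    {H : Type w} [NormedAddCommGroup H] [InnerProductSpace ℂ H]
    [CompleteSpace H] (ρ : ReducedCStar 𝒢 →⋆ₙₐ[ℂ] (H →L[ℂ] H)) (hρ : Function.Injective ρ) :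
    ∃ Φ : ReducedCrossedProduct β ρ ≃⋆ₐ[ℂ] ReducedCStar (Semidirect α),
      ∀ (f : Cc 𝒢) (h : G), Φ (toCrossed β ρ (CrossedAlg.single β h (toReduced f))) =
        toReduced (Cc.slice α h f) := by
  let j : CrossedAlg β →⋆ₙₐ[ℂ] ReducedCStar (Semidirect α) :=
    NonUnitalStarAlgHom.codRestrict (fiberRepFamily α β) _ (fiberRepFamily_mem β hβ)
  have hj : ∀ h f, j (CrossedAlg.single β h (toReduced f)) = toReduced (Cc.slice α h f) :=
    fun h f => Subtype.ext (fiberRepFamily_single β hβ h f)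
  have hdense : DenseRange j := by
    refine denseRange_toReduced.mono ?_
    rintro _ ⟨F, rfl⟩
    -- The range of `j` contains all of `C_c(𝒢 ⋊ G)`, since it contains every slice.
    obtain ⟨S, f, rfl⟩ := F.exists_eq_sum_slice
    refine ⟨∑ h ∈ S, CrossedAlg.single β h (toReduced (f h)), ?_⟩
    rw [map_sum, map_sum]
    exact Finset.sum_congr rfl fun h _ => hj h (f h)
  obtain ⟨Φ, hΦ⟩ := exists_starAlgEquiv_of_norm_eq (toCrossed β ρ) j (denseRange_toCrossed β ρ)
    hdense fun x => (norm_fiberRepFamily (α := α) β ρ hρ x).symm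
  exact ⟨Φ, fun f h => (hΦ _).trans (hj h f)⟩

end CrossedIso

end EtaleGpd

theorem mainTheorem9 {𝒢 : Type u} [TopologicalSpace 𝒢] [Gpd 𝒢] [IsEtale 𝒢]
    {G : Type v} [Group G] [Countable G] [TopologicalSpace G] [DiscreteTopology G]
    (α : G →* GpdAut 𝒢) :
    ∃ β : G →* (ReducedCStar 𝒢 ≃⋆ₐ[ℂ] ReducedCStar 𝒢),
      (∀ (g : G) (f : Cc 𝒢), ∃ f' : Cc 𝒢,
        β g (toReduced f) = toReduced f' ∧ ∀ γ : 𝒢, f' γ = f ((α g)⁻¹ γ)) ∧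
      ∀ (H : Type w) [NormedAddCommGroup H] [InnerProductSpace ℂ H] [CompleteSpace H]
        (ρ : ReducedCStar 𝒢 →⋆ₙₐ[ℂ] (H →L[ℂ] H)), Function.Injective ρ →
        ∃ Φ : ReducedCrossedProduct β ρ ≃⋆ₐ[ℂ] ReducedCStar (Semidirect α),
          ∀ (f : Cc 𝒢) (h : G), ∃ F : Cc (Semidirect α),
            Φ (toCrossed β ρ (CrossedAlg.single β h (toReduced f))) = toReduced F ∧
            (∀ γ : 𝒢, F (Semidirect.mk α γ h) = f γ) ∧
            (∀ (γ : 𝒢) (g : G), g ≠ h → F (Semidirect.mk α γ g) = 0) := by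
  obtain ⟨β, hβ⟩ := exists_reducedAction α
  refine ⟨β, fun g f => ⟨_, hβ g f, fun _ => rfl⟩, fun H _ _ _ ρ hρ => ?_⟩
  obtain ⟨Φ, hΦ⟩ := exists_crossedProduct_equiv β hβ ρ hρ
  exact ⟨Φ, fun f h => ⟨_, hΦ f h, fun _ => if_pos rfl, fun _ _ hg => if_neg hg⟩⟩
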